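/- Let $\mathbb D$ be the open unit disk and let $0\le\beta\le 1$. Let $f:\mathbb D\to\mathbb C$ be either holomorphic and injective, or of the form $f(z)=a_0+a_nz^n$ with an integer $n\ge 1$ and $a_0,a_n\in\mathbb C$ (possibly $a_n=0$). For $0<r<1$ let $L(f,r)$ be the length (one-dimensional Hausdorff measure) of the boundary $\partial f(r\mathbb D)$ of the set $f(r\mathbb D)$, where $r\mathbb D=\{|z|<r\}$. For $\alpha\in\mathbb R$ put $$\Phi_{L,\beta}(f,t)=\frac{L(f,t)}{(2\pi t)^\beta},\qquad d\mu_\alpha(t)=(1-t^2)^\alpha\,d(t^2)=2t(1-t^2)^\alpha\,dt,$$ $$\mathsf L_{\alpha,\beta}(f,r)=\frac{\int_0^r\Phi_{L,\beta}(f,t)\,d\mu_\alpha(t)}{\int_0^r d\mu_\alpha(t)}\quad(0<r<1),\qquad \mathsf L_{\alpha,\beta}(f,1)=\sup_{0<s<1}\mathsf L_{\alpha,\beta}(f,s)\in[0,\infty].$$ Call $f$ exceptional if $\beta<1$ and $f$ is constant, or $\beta=1$ and $f(z)=a_0+a_1z$ for some $a_0,a_1\in\mathbb C$ (possibly $a_1=0$).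 Then $\mathsf L_{\alpha,\beta}(f,r)<\infty$ for all $\alpha\in\mathbb R$ and $0<r<1$, and the following hold. (i) If $\alpha\le-1$, then $$\int_0^1\Phi_{L,\beta}(f,t)\,d\mu_\alpha(t)=\sup_{0<r<1}\int_0^r\Phi_{L,\beta}(f,t)\,d\mu_\alpha(t),$$ and this quantity is finite if and only if $f$ is constant. Moreover, the limit $\Phi_{L,\beta}(f,1):=\lim_{r\to1^-}\Phi_{L,\beta}(f,r)$ exists in $[0,\infty]$ and $\sup_{0<r<1}\mathsf L_{\alpha,\beta}(f,r)=\Phi_{L,\beta}(f,1)$. (ii) If $\alpha>-1$, then $\mathsf L_{\alpha,\beta}(f,r)\le\mathsf L_{\alpha,\beta}(f,1)$ for all $0<r<1$, with equality for all $r\in(0,1)$ if and only if $f$ is exceptional. (iii) The function $\alpha\mapsto\mathsf L_{\alpha,\beta}(f,1)\in[0,\infty]$ is nonincreasing on $(-1,\infty)$. It is strictly decreasing where finite, in the sense that $\mathsf L_{\alpha_2,\beta}(f,1)<\mathsf L_{\alpha_1,\beta}(f,1)$ whenever $-1<\alpha_1<\alpha_2$ and $\mathsf L_{\alpha_2,\beta}(f,1)<\infty$,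 if and only if $f$ is not exceptional. -/

import Mathlib

open MeasureTheory Set Filter Topology
open scoped ENNReal

noncomputable section

/-- `f` is holomorphic and injective (univalent) on the open unit disk. -/
def UnivalentOnDisk (f : ℂ → ℂ) : Prop :=
  DifferentiableOn ℂ f (Metric.ball 0 1) ∧ InjOn f (Metric.ball 0 1)

/-- On the open unit disk, `f z = a₀ + aₙ z ^ n` for some integer `n ≥ 1`
(the coefficient `aₙ` may vanish, so constants are included). -/
def MonomialOnDisk (f : ℂ → ℂ) : Prop :=
  ∃ (a₀ a : ℂ) (n : ℕ), 1 ≤ n ∧ ∀ z ∈ Metric.ball (0 : ℂ) 1, f z = a₀ + a * z ^ n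

/-- `f` is constant on the open unit disk. -/
def ConstOnDisk (f : ℂ → ℂ) : Prop :=
  ∃ c : ℂ, ∀ z ∈ Metric.ball (0 : ℂ) 1, f z = c

/-- `f` is a linear map `a₀ + a₁ z` on the open unit disk. -/
def LinearOnDisk (f : ℂ → ℂ) : Prop :=
  ∃ a₀ a₁ : ℂ, ∀ z ∈ Metric.ball (0 : ℂ) 1, f z = a₀ + a₁ * z

/-- The exceptional maps: the constants when `β < 1`, the linear maps when `β = 1`. -/
def Exceptional (β : ℝ) (f : ℂ → ℂ) : Prop :=
  (β < 1 ∧ ConstOnDisk f) ∨ (β = 1 ∧ LinearOnDisk f)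

/-- `L(f, r)`: the length (one-dimensional Hausdorff measure) of the boundary of the planar set
`f (r𝔻)`. -/
def bdryLength (f : ℂ → ℂ) (r : ℝ) : ℝ≥0∞ :=
  Measure.hausdorffMeasure 1 (frontier (f '' Metric.ball 0 r))

/-- The mixed length `Φ_{L,β}(f, t) = L(f, t) / (2πt)^β`. -/
def mixedLength (β : ℝ) (f : ℂ → ℂ) (t : ℝ) : ℝ≥0∞ :=
  bdryLength f t / ENNReal.ofReal ((2 * Real.pi * t) ^ β)

/-- The measure `dμ_α(t) = (1 - t²)^α d(t²) = 2t (1 - t²)^α dt` on `(0, 1)`. -/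
def weightMeasure (α : ℝ) : Measure ℝ :=
  (volume.restrict (Ioo 0 1)).withDensity
    fun t => ENNReal.ofReal (2 * t * (1 - t ^ 2) ^ α)

/-- The weighted integral mean `𝖫_{α,β}(f, r)` of the mixed length, for `0 < r < 1`. -/
def lengthMean (α β : ℝ) (f : ℂ → ℂ) (r : ℝ) : ℝ≥0∞ :=
  (∫⁻ t in Ioo 0 r, mixedLength β f t ∂(weightMeasure α)) / weightMeasure α (Ioo 0 r)

/-- `𝖫_{α,β}(f, 1)`, the supremum of `𝖫_{α,β}(f, s)` over `0 < s < 1`, in `[0, ∞]`. -/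
def lengthMeanOne (α β : ℝ) (f : ℂ → ℂ) : ℝ≥0∞ :=
  ⨆ s ∈ Ioo (0 : ℝ) 1, lengthMean α β f s

end

/-! Everything follows from one dichotomy for `Φ = mixedLength β f` on `(0, 1)`: it is finite, and
it is constant if `f` is exceptional and strictly increasing otherwise (`mixedLength_dichotomy`).

To see this, write `Φ(t) = (2πt)^(1-β) M(t)` with `M(t) = L(f, t) / (2πt)`. For univalent `f` the
boundary of `f(t𝔻)` is the simple curve `θ ↦ f(t e^{iθ})`, so `M(t)` is the mean of `|f'|` over the
circle `|z| = t`. Since `f'` has no zeros, `f' = g²` with `g` holomorphic, and Parseval gives `M(t)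
= ∑ |g_n|² t^(2n)`, which increases strictly unless `g` is constant, that is, unless `f` is linear.
For `a₀ + a z^n` the image is a disk and `M(t) = |a| t^(n-1)`.

The rest concerns weighted means of an increasing function. Enlarging the interval raises the mean.
For `α ≤ -1` the weight has infinite mass near `1`, so the means climb to the limit of `Φ` at `1`
(`iSup_weightedMean_eq_iSup`) and the integral diverges unless `Φ` vanishes. For `α > -1` the
supremum of the means is the mean over all of `(0, 1)`; a larger `α` shifts mass towards `0`, and
Chebyshev's inequality shows that this lowers the mean (`weightedMean_one_anti`). -/

/-! ### Masses of intervals under the weights. -/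

lemma weightMeasure_apply_Ioo (α : ℝ) {s r : ℝ} (hs : 0 ≤ s) (hr : r ≤ 1) :
    weightMeasure α (Ioo s r) =
      ∫⁻ t in Ioo s r, ENNReal.ofReal (2 * t * (1 - t ^ 2) ^ α) := by
  rw [weightMeasure, withDensity_apply _ measurableSet_Ioo,
    Measure.restrict_restrict measurableSet_Ioo,
    inter_eq_left.mpr (Ioo_subset_Ioo hs hr)]

lemma weight_pos (α : ℝ) {t : ℝ} (ht : t ∈ Ioo (0 : ℝ) 1) : 0 < 2 * t * (1 - t ^ 2) ^ α := by
  have h1 : 0 < 1 - t ^ 2 := by nlinarith [ht.1, ht.2]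
  have := ht.1
  positivity

lemma weightMeasure_Ioo_pos (α : ℝ) {s r : ℝ} (hs : 0 ≤ s) (hsr : s < r) (hr : r ≤ 1) :
    0 < weightMeasure α (Ioo s r) := by
  rw [weightMeasure_apply_Ioo α hs hr, setLIntegral_pos_iff (by fun_prop)]
  have : Ioo s r ⊆ (Function.support fun t : ℝ ↦
      ENNReal.ofReal (2 * t * (1 - t ^ 2) ^ α)) ∩ Ioo s r := fun t ht ↦
    ⟨(ENNReal.ofReal_pos.mpr (weight_pos α ⟨hs.trans_lt ht.1, ht.2.trans_le hr⟩)).ne', ht⟩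
  refine lt_of_lt_of_le ?_ (measure_mono this)
  simpa using hsr

lemma weightMeasure_Ioo_lt_top (α : ℝ) {r : ℝ} (hr : r < 1) :
    weightMeasure α (Ioo 0 r) < ⊤ := by
  rw [weightMeasure_apply_Ioo α le_rfl hr.le]
  have hc : ContinuousOn (fun t : ℝ ↦ 2 * t * (1 - t ^ 2) ^ α) (Icc 0 r) := by
    refine ContinuousOn.mul (by fun_prop) (ContinuousOn.rpow_const (by fun_prop) ?_)
    intro t ht
    left
    nlinarith [ht.1, ht.2]
  exact (hc.integrableOn_Icc.mono_set Ioo_subset_Icc_self).lintegral_lt_top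

lemma weightMeasure_Ioo_eq_of_hasDerivAt (α : ℝ) {s r : ℝ} (hs : 0 ≤ s) (hsr : s ≤ r)
    (hr : r ≤ 1) {F : ℝ → ℝ} (hF : ContinuousOn F (Icc s r))
    (hF' : ∀ t ∈ Ioo s r, HasDerivAt F (2 * t * (1 - t ^ 2) ^ α) t) :
    weightMeasure α (Ioo s r) = ENNReal.ofReal (F r - F s) := by
  have hpos : ∀ t ∈ Ioo s r, 0 ≤ 2 * t * (1 - t ^ 2) ^ α := fun t ht ↦
    (weight_pos α ⟨hs.trans_lt ht.1, ht.2.trans_le hr⟩).le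
  have hint : IntegrableOn (fun t : ℝ ↦ 2 * t * (1 - t ^ 2) ^ α) (Ioc s r) :=
    intervalIntegral.integrableOn_deriv_of_nonneg hF hF' hpos
  rw [weightMeasure_apply_Ioo α hs hr, ← intervalIntegral.integral_eq_sub_of_hasDerivAt_of_le hsr
    hF hF' ((intervalIntegrable_iff_integrableOn_Ioc_of_le hsr).mpr hint),
    intervalIntegral.integral_of_le hsr, integral_Ioc_eq_integral_Ioo,
    ofReal_integral_eq_lintegral_ofReal (hint.mono_set Ioo_subset_Ioc_self)]
  exact (ae_restrict_iff' measurableSet_Ioo).mpr (ae_of_all _ hpos)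

lemma weightMeasure_Ioo_zero_one {α : ℝ} (hα : -1 < α) :
    weightMeasure α (Ioo 0 1) = ENNReal.ofReal (1 / (α + 1)) := by
  have h1 : 0 < α + 1 := by linarith
  rw [weightMeasure_Ioo_eq_of_hasDerivAt α le_rfl zero_le_one le_rfl
    (F := fun t ↦ -((1 - t ^ 2) ^ (α + 1) / (α + 1)))]
  · simp [Real.zero_rpow h1.ne']
  · refine ContinuousOn.neg (ContinuousOn.div_const (ContinuousOn.rpow_const (by fun_prop) ?_) _)
    exact fun _ _ ↦ Or.inr h1.le
  · intro t ht
    have h2 : 1 - t ^ 2 ≠ 0 := by nlinarith [ht.1, ht.2]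
    have h3 : HasDerivAt (fun t : ℝ ↦ 1 - t ^ 2) (-(2 * t)) t := by
      simpa using (hasDerivAt_pow 2 t).const_sub 1
    refine ((h3.rpow_const (p := α + 1) (Or.inl h2)).div_const (α + 1)).neg.congr_deriv ?_
    rw [add_sub_cancel_right]
    field_simp

lemma weightMeasure_neg_one_Ioo {s r : ℝ} (hs : 0 ≤ s) (hsr : s ≤ r) (hr : r < 1) :
    weightMeasure (-1) (Ioo s r) = ENNReal.ofReal (Real.log (1 - s ^ 2) - Real.log (1 - r ^ 2)) := by
  have hne : ∀ t ∈ Icc s r, 1 - t ^ 2 ≠ 0 := fun t ht ↦ by nlinarith [ht.1, ht.2]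
  rw [weightMeasure_Ioo_eq_of_hasDerivAt (-1) hs hsr hr.le (F := fun t ↦ -Real.log (1 - t ^ 2))]
  · ring_nf
  · exact (ContinuousOn.log (by fun_prop) hne).neg
  · intro t ht
    have h3 : HasDerivAt (fun t : ℝ ↦ 1 - t ^ 2) (-(2 * t)) t := by
      simpa using (hasDerivAt_pow 2 t).const_sub 1
    refine (h3.log (hne t (Ioo_subset_Icc_self ht))).neg.congr_deriv ?_
    rw [Real.rpow_neg_one]
    ring

/-- Since `0 < 1 - t² < 1`, lowering the exponent raises the weight, so `α = -1` is the extreme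
case; there the primitive `-log (1 - t²)` diverges at `1`. -/
lemma weightMeasure_Ioo_one_eq_top {α : ℝ} (hα : α ≤ -1) {s : ℝ} (hs : 0 ≤ s) (hs1 : s < 1) :
    weightMeasure α (Ioo s 1) = ⊤ := by
  have hle : weightMeasure (-1) (Ioo s 1) ≤ weightMeasure α (Ioo s 1) := by
    rw [weightMeasure_apply_Ioo _ hs le_rfl, weightMeasure_apply_Ioo _ hs le_rfl]
    refine setLIntegral_mono' measurableSet_Ioo fun t ht ↦ ENNReal.ofReal_le_ofReal ?_
    have h0 : 0 ≤ t := hs.trans ht.1.le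
    refine mul_le_mul_of_nonneg_left ?_ (by positivity)
    exact Real.rpow_le_rpow_of_exponent_ge (by nlinarith [ht.2]) (by nlinarith) hα
  refine top_le_iff.mp (le_trans ?_ hle)
  have hlim : Tendsto (fun r : ℝ ↦ ENNReal.ofReal (Real.log (1 - s ^ 2) - Real.log (1 - r ^ 2)))
      (𝓝[<] 1) (𝓝 ⊤) := by
    refine ENNReal.tendsto_ofReal_nhds_top.mpr ?_
    refine tendsto_atTop_add_const_left _ _ (tendsto_neg_atBot_atTop.comp ?_)
    refine Real.tendsto_log_nhdsGT_zero.comp (tendsto_nhdsWithin_iff.mpr ⟨?_, ?_⟩)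
    · have : Tendsto (fun r : ℝ ↦ 1 - r ^ 2) (𝓝 1) (𝓝 (1 - 1 ^ 2)) :=
        Continuous.tendsto (by fun_prop) 1
      simpa using this.mono_left nhdsWithin_le_nhds
    · filter_upwards [Ioo_mem_nhdsLT (zero_lt_one' ℝ)] with r hr
      simp only [mem_Ioi]
      nlinarith [hr.1, hr.2]
  refine le_of_tendsto hlim ?_
  filter_upwards [Ioo_mem_nhdsLT hs1] with r hr
  rw [← weightMeasure_neg_one_Ioo hs hr.1.le hr.2]
  exact measure_mono (Ioo_subset_Ioo_right hr.2.le)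

lemma setLIntegral_Ioo_eq_iSup (μ : Measure ℝ) (Φ : ℝ → ℝ≥0∞) :
    ∫⁻ t in Ioo 0 1, Φ t ∂μ = ⨆ r ∈ Ioo (0 : ℝ) 1, ∫⁻ t in Ioo 0 r, Φ t ∂μ := by
  refine le_antisymm ?_ (iSup₂_le fun r hr ↦ lintegral_mono_set (Ioo_subset_Ioo_right hr.2.le))
  obtain ⟨u, hu, hu1, hlim⟩ := exists_seq_strictMono_tendsto' (zero_lt_one' ℝ)
  have hU : Ioo (0 : ℝ) 1 = ⋃ n, Ioo 0 (u n) := by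
    ext t
    simp only [mem_Ioo, mem_iUnion]
    refine ⟨fun ht ↦ ?_, fun ⟨n, hn⟩ ↦ ⟨hn.1, hn.2.trans (hu1 n).2⟩⟩
    obtain ⟨n, hn⟩ := (hlim.eventually_const_lt ht.2).exists
    exact ⟨n, ht.1, hn⟩
  rw [hU, setLIntegral_iUnion_of_directed]
  · exact iSup_le fun n ↦ le_iSup₂_of_le (u n) (hU ▸ hu1 n) le_rfl
  · exact Monotone.directed_le fun m n hmn ↦ Ioo_subset_Ioo_right (hu.monotone hmn)

/-- The mean of `Φ` over `(0, r)` with respect to the weight `(1 - t²)^α d(t²)`. -/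
noncomputable def weightedMean (α : ℝ) (Φ : ℝ → ℝ≥0∞) (r : ℝ) : ℝ≥0∞ :=
  (∫⁻ t in Ioo 0 r, Φ t ∂(weightMeasure α)) / weightMeasure α (Ioo 0 r)

/-! ### Weighted means of an increasing function. -/

section Means

variable {α : ℝ} {Φ : ℝ → ℝ≥0∞} {r s : ℝ}

lemma weightMeasure_Ioo_zero_ne_zero (hr0 : 0 < r) (hr1 : r ≤ 1) :
    weightMeasure α (Ioo 0 r) ≠ 0 :=
  (weightMeasure_Ioo_pos α le_rfl hr0 hr1).ne'

lemma setLIntegral_le_of_monotoneOn (hΦ : MonotoneOn Φ (Ioo 0 1)) (hr : r ∈ Ioo (0 : ℝ) 1) :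
    ∫⁻ t in Ioo 0 r, Φ t ∂(weightMeasure α) ≤ Φ r * weightMeasure α (Ioo 0 r) := by
  rw [← setLIntegral_const]
  exact setLIntegral_mono' measurableSet_Ioo fun t ht ↦ hΦ ⟨ht.1, ht.2.trans hr.2⟩ hr ht.2.le

lemma weightedMean_le (hΦ : MonotoneOn Φ (Ioo 0 1)) (hr : r ∈ Ioo (0 : ℝ) 1) :
    weightedMean α Φ r ≤ Φ r :=
  ENNReal.div_le_of_le_mul (setLIntegral_le_of_monotoneOn hΦ hr)

lemma weightedMean_lt (hΦ : StrictMonoOn Φ (Ioo 0 1)) (hfin : ∀ t ∈ Ioo (0 : ℝ) 1, Φ t ≠ ⊤)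
    (hr : r ∈ Ioo (0 : ℝ) 1) : weightedMean α Φ r < Φ r := by
  have hμ := (weightMeasure_Ioo_lt_top α hr.2).ne
  have h0 := weightMeasure_Ioo_zero_ne_zero (α := α) hr.1 hr.2.le
  rw [weightedMean, ENNReal.div_lt_iff (Or.inl h0) (Or.inl hμ), ← setLIntegral_const]
  refine setLIntegral_strict_mono measurableSet_Ioo h0 measurable_const ?_
    (ae_of_all _ fun t ht ↦ hΦ ⟨ht.1, ht.2.trans hr.2⟩ hr ht.2)
  exact ((setLIntegral_le_of_monotoneOn hΦ.monotoneOn hr).trans_lt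
    (ENNReal.mul_lt_top (hfin r hr).lt_top hμ.lt_top)).ne

lemma weightMeasure_Ioo_split (hr : 0 < r) (hrs : r < s) :
    weightMeasure α (Ioo 0 s) = weightMeasure α (Ioo 0 r) + weightMeasure α (Ico r s) := by
  rw [← Ioo_union_Ico_eq_Ioo hr hrs.le, measure_union _ measurableSet_Ico]
  exact disjoint_left.mpr fun t h h' ↦ not_le.mpr h.2 h'.1

lemma setLIntegral_Ioo_split (hr : 0 < r) (hrs : r < s) :
    ∫⁻ t in Ioo 0 s, Φ t ∂(weightMeasure α) =
      ∫⁻ t in Ioo 0 r, Φ t ∂(weightMeasure α) + ∫⁻ t in Ico r s, Φ t ∂(weightMeasure α) := by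
  rw [← Ioo_union_Ico_eq_Ioo hr hrs.le, lintegral_union measurableSet_Ico]
  exact disjoint_left.mpr fun t h h' ↦ not_le.mpr h.2 h'.1

lemma mul_le_setLIntegral_Ico (hΦ : MonotoneOn Φ (Ioo 0 1)) (hr : r ∈ Ioo (0 : ℝ) 1)
    (hs : s ≤ 1) :
    Φ r * weightMeasure α (Ico r s) ≤ ∫⁻ t in Ico r s, Φ t ∂(weightMeasure α) := by
  rw [← setLIntegral_const]
  exact setLIntegral_mono' measurableSet_Ico fun t ht ↦
    hΦ hr ⟨hr.1.trans_le ht.1, ht.2.trans_le hs⟩ ht.1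

lemma weightedMean_mul (hr : r ∈ Ioo (0 : ℝ) 1) :
    weightedMean α Φ r * weightMeasure α (Ioo 0 r) =
      ∫⁻ t in Ioo 0 r, Φ t ∂(weightMeasure α) :=
  ENNReal.div_mul_cancel (weightMeasure_Ioo_zero_ne_zero hr.1 hr.2.le)
    (weightMeasure_Ioo_lt_top α hr.2).ne

/-- Passing from `(0, r)` to `(0, s)` adds the values on `[r, s)`, all at least `Φ r`, while the
mean over `(0, r)` is at most `Φ r`. The endpoint `s = 1` is admitted when the total mass is finite.
-/
lemma weightedMean_mono (hΦ : MonotoneOn Φ (Ioo 0 1)) (hr : r ∈ Ioo (0 : ℝ) 1) (hrs : r < s)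
    (hs : s ≤ 1) (hμ : weightMeasure α (Ioo 0 s) ≠ ⊤) :
    weightedMean α Φ r ≤ weightedMean α Φ s := by
  rw [weightedMean, weightedMean, ENNReal.le_div_iff_mul_le
    (Or.inl (weightMeasure_Ioo_zero_ne_zero (hr.1.trans hrs) hs)) (Or.inl hμ),
    ← weightedMean, weightMeasure_Ioo_split hr.1 hrs, setLIntegral_Ioo_split hr.1 hrs, mul_add,
    weightedMean_mul hr]
  gcongr
  exact le_trans (by gcongr; exact weightedMean_le hΦ hr) (mul_le_setLIntegral_Ico hΦ hr hs)

lemma weightedMean_strictMono (hΦ : StrictMonoOn Φ (Ioo 0 1))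
    (hfin : ∀ t ∈ Ioo (0 : ℝ) 1, Φ t ≠ ⊤) (hr : r ∈ Ioo (0 : ℝ) 1) (hrs : r < s) (hs : s < 1) :
    weightedMean α Φ r < weightedMean α Φ s := by
  have hμ := (weightMeasure_Ioo_lt_top α hs).ne
  have hI : ∫⁻ t in Ioo 0 r, Φ t ∂(weightMeasure α) ≠ ⊤ :=
    ((setLIntegral_le_of_monotoneOn hΦ.monotoneOn hr).trans_lt
      (ENNReal.mul_lt_top (hfin r hr).lt_top (weightMeasure_Ioo_lt_top α hr.2))).ne
  rw [weightedMean, weightedMean, ENNReal.lt_div_iff_mul_lt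
    (Or.inl (weightMeasure_Ioo_zero_ne_zero (hr.1.trans hrs) hs.le)) (Or.inl hμ),
    ← weightedMean, weightMeasure_Ioo_split hr.1 hrs, setLIntegral_Ioo_split hr.1 hrs, mul_add,
    weightedMean_mul hr]
  refine ENNReal.add_lt_add_left hI
    (lt_of_lt_of_le ?_ (mul_le_setLIntegral_Ico hΦ.monotoneOn hr hs.le))
  refine ENNReal.mul_lt_mul_left ?_ ?_ (weightedMean_lt hΦ hfin hr)
  · exact ((weightMeasure_Ioo_pos α hr.1.le hrs hs.le).trans_le
      (measure_mono Ioo_subset_Ico_self)).ne'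
  · exact ((measure_mono (Ico_subset_Ioo_left hr.1)).trans_lt hμ.lt_top).ne

lemma iSup_weightedMean_eq_weightedMean_one (hα : -1 < α) (hΦ : MonotoneOn Φ (Ioo 0 1)) :
    ⨆ s ∈ Ioo (0 : ℝ) 1, weightedMean α Φ s = weightedMean α Φ 1 := by
  have hμ : weightMeasure α (Ioo 0 1) ≠ ⊤ := by simp [weightMeasure_Ioo_zero_one hα]
  refine le_antisymm (iSup₂_le fun r hr ↦ weightedMean_mono hΦ hr hr.2 le_rfl hμ) ?_
  rw [weightedMean, setLIntegral_Ioo_eq_iSup, div_eq_mul_inv, ENNReal.iSup_mul]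
  refine iSup_mono fun r ↦ ?_
  rw [ENNReal.iSup_mul]
  refine iSup_mono fun hr ↦ ?_
  rw [weightedMean, div_eq_mul_inv]
  gcongr
  exact hr.2.le

/-- If the supremum `S` of the means were below `Φ s`, then beyond `s` the integral would gain at
least `Φ s` per unit mass but stay below `S` times the total mass. Hence `(Φ s - S) μ(0, r)` would
be bounded in `r`, although `μ(0, r)` tends to infinity. -/
lemma iSup_weightedMean_eq_iSup (hα : α ≤ -1) (hΦ : MonotoneOn Φ (Ioo 0 1))
    (hfin : ∀ t ∈ Ioo (0 : ℝ) 1, Φ t ≠ ⊤) :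
    ⨆ r ∈ Ioo (0 : ℝ) 1, weightedMean α Φ r = ⨆ r ∈ Ioo (0 : ℝ) 1, Φ r := by
  refine le_antisymm (iSup₂_mono fun r hr ↦ weightedMean_le hΦ hr) (iSup₂_le fun s hs ↦ ?_)
  set S := ⨆ r ∈ Ioo (0 : ℝ) 1, weightedMean α Φ r with hS
  by_contra! hlt
  have hbound : ∀ r ∈ Ioo (0 : ℝ) 1, (Φ s - S) * weightMeasure α (Ioo 0 r) ≤
      Φ s * weightMeasure α (Ioo 0 s) := by
    intro r hr
    rcases le_or_gt r s with hrs | hrs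
    · gcongr
      exact tsub_le_self
    · rw [ENNReal.sub_mul fun _ _ ↦ (weightMeasure_Ioo_lt_top α hr.2).ne, tsub_le_iff_right]
      calc Φ s * weightMeasure α (Ioo 0 r)
          = Φ s * weightMeasure α (Ioo 0 s) + Φ s * weightMeasure α (Ico s r) := by
            rw [weightMeasure_Ioo_split hs.1 hrs, mul_add]
        _ ≤ Φ s * weightMeasure α (Ioo 0 s) + ∫⁻ t in Ioo 0 r, Φ t ∂(weightMeasure α) := by
            gcongr
            refine (mul_le_setLIntegral_Ico hΦ hs hr.2.le).trans ?_
            exact lintegral_mono_set (Ico_subset_Ioo_left hs.1)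
        _ ≤ _ := by
            rw [← weightedMean_mul hr]
            gcongr
            exact le_iSup₂_of_le r hr le_rfl
  have htop : ⨆ r ∈ Ioo (0 : ℝ) 1, weightMeasure α (Ioo 0 r) = ⊤ := by
    have := setLIntegral_Ioo_eq_iSup (weightMeasure α) fun _ ↦ 1
    simp only [setLIntegral_one] at this
    rw [← this, weightMeasure_Ioo_one_eq_top hα le_rfl zero_lt_one]
  have hle : (Φ s - S) * ⊤ ≤ Φ s * weightMeasure α (Ioo 0 s) := by
    rw [← htop]
    simp_rw [ENNReal.mul_iSup]
    exact iSup₂_le hbound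
  rw [ENNReal.mul_top (tsub_pos_of_lt hlt).ne', top_le_iff] at hle
  exact (ENNReal.mul_lt_top (hfin s hs).lt_top (weightMeasure_Ioo_lt_top α hs.2)).ne hle

lemma tendsto_iSup_of_monotoneOn (hΦ : MonotoneOn Φ (Ioo 0 1)) :
    Tendsto Φ (𝓝[<] 1) (𝓝 (⨆ r ∈ Ioo (0 : ℝ) 1, Φ r)) := by
  rw [← sSup_image]
  exact hΦ.tendsto_nhdsWithin_Ioo_left ⟨1 / 2, by norm_num, by norm_num⟩ (OrderTop.bddAbove _)

lemma setLIntegral_eq_top_of_ne_zero (hα : α ≤ -1) (hΦ : MonotoneOn Φ (Ioo 0 1))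
    (hs : s ∈ Ioo (0 : ℝ) 1) (h0 : Φ s ≠ 0) :
    ∫⁻ t in Ioo 0 1, Φ t ∂(weightMeasure α) = ⊤ := by
  refine top_le_iff.mp ?_
  calc ⊤ = Φ s * weightMeasure α (Ioo s 1) := by
        rw [weightMeasure_Ioo_one_eq_top hα hs.1.le hs.2, ENNReal.mul_top h0]
    _ ≤ Φ s * weightMeasure α (Ico s 1) := by gcongr; exact Ioo_subset_Ico_self
    _ ≤ _ := (mul_le_setLIntegral_Ico hΦ hs le_rfl).trans
        (lintegral_mono_set (Ico_subset_Ioo_left hs.1))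

lemma weightedMean_const {c : ℝ≥0∞} (hc : ∀ t ∈ Ioo (0 : ℝ) 1, Φ t = c)
    (hr : r ∈ Ioo (0 : ℝ) 1) : weightedMean α Φ r = c := by
  rw [weightedMean, setLIntegral_congr_fun measurableSet_Ioo
    (fun t ht ↦ hc t ⟨ht.1, ht.2.trans hr.2⟩), setLIntegral_const,
    ENNReal.mul_div_cancel_right (weightMeasure_Ioo_zero_ne_zero hr.1 hr.2.le)
    (weightMeasure_Ioo_lt_top α hr.2).ne]

end Means

/-! ### Comparison of two exponents by Chebyshev's inequality. -/

lemma setLIntegral_weightMeasure (α : ℝ) (Φ : ℝ → ℝ≥0∞) :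
    ∫⁻ t in Ioo 0 1, Φ t ∂(weightMeasure α) =
      ∫⁻ t in Ioo 0 1, ENNReal.ofReal (2 * t * (1 - t ^ 2) ^ α) * Φ t := by
  rw [weightMeasure, setLIntegral_withDensity_eq_setLIntegral_mul_non_measurable _ (by fun_prop)
      _ measurableSet_Ioo (ae_of_all _ fun t ↦ ENNReal.ofReal_lt_top),
    Measure.restrict_restrict measurableSet_Ioo, inter_self]
  rfl

lemma exists_rpow_eq {k δ : ℝ} (hk0 : 0 < k) (hk1 : k < 1) (hδ : 0 < δ) :
    ∃ t ∈ Ioo (0 : ℝ) 1, (1 - t ^ 2) ^ δ = k := by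
  have h0 : 0 < k ^ δ⁻¹ := Real.rpow_pos_of_pos hk0 _
  have h1 : k ^ δ⁻¹ < 1 := Real.rpow_lt_one hk0.le hk1 (inv_pos.mpr hδ)
  refine ⟨√(1 - k ^ δ⁻¹), ⟨Real.sqrt_pos.mpr (by linarith), ?_⟩, ?_⟩
  · rw [Real.sqrt_lt' one_pos]
    linarith
  · rw [Real.sq_sqrt (by linarith), sub_sub_cancel, Real.rpow_inv_rpow hk0.le hδ.ne']

section Comparison

variable {α₁ α₂ : ℝ} {Φ : ℝ → ℝ≥0∞}

lemma rpow_lt_rpow_of_lt {δ s t : ℝ} (hδ : 0 < δ) (hs : 0 < s) (hst : s < t) (ht : t < 1) :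
    (1 - t ^ 2) ^ δ < (1 - s ^ 2) ^ δ :=
  Real.rpow_lt_rpow (by nlinarith) (by nlinarith) hδ

lemma weight_eq_mul {t : ℝ} (ht : t ∈ Ioo (0 : ℝ) 1) :
    2 * t * (1 - t ^ 2) ^ α₂ = (1 - t ^ 2) ^ (α₂ - α₁) * (2 * t * (1 - t ^ 2) ^ α₁) := by
  have h1 : 0 < 1 - t ^ 2 := by nlinarith [ht.1, ht.2]
  rw [mul_left_comm, ← Real.rpow_add h1, sub_add_cancel]

/-- Bookkeeping that moves the Chebyshev inequality to the reals: `w` is the weight at `t`, `h` and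
`k` are the weight ratios at `t` and `s`, `x` and `c` the values of `Φ` there. -/
lemma ofReal_weight_mul_add {x c k h w : ℝ} (hx : 0 ≤ x) (hc : 0 ≤ c) (hk : 0 ≤ k) (hh : 0 ≤ h)
    (hw : 0 ≤ w) :
    ENNReal.ofReal (h * w) * ENNReal.ofReal x +
        ENNReal.ofReal k * ENNReal.ofReal c * ENNReal.ofReal w =
      ENNReal.ofReal (w * (h * x + k * c)) := by
  rw [← ENNReal.ofReal_mul (by positivity), ← ENNReal.ofReal_mul hk,
    ← ENNReal.ofReal_mul (by positivity), ← ENNReal.ofReal_add (by positivity) (by positivity)]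
  ring_nf

lemma ofReal_weight_mul_add' {x c k h w : ℝ} (hx : 0 ≤ x) (hc : 0 ≤ c) (hk : 0 ≤ k) (hh : 0 ≤ h)
    (hw : 0 ≤ w) :
    ENNReal.ofReal k * (ENNReal.ofReal w * ENNReal.ofReal x) +
        ENNReal.ofReal c * ENNReal.ofReal (h * w) =
      ENNReal.ofReal (w * (k * x + h * c)) := by
  rw [← ENNReal.ofReal_mul (by positivity), ← ENNReal.ofReal_mul hk,
    ← ENNReal.ofReal_mul hc, ← ENNReal.ofReal_add (by positivity) (by positivity)]
  ring_nf

/-- With `h(t) = (1 - t²)^(α₂ - α₁)` decreasing and `Φ` increasing, `(h(t) - h(s)) (Φ(t) - Φ(s)) ≤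
0`. This is multiplied by the `α₁`-weight at `t` and expanded with all terms positive, to avoid
subtraction in `ℝ≥0∞`. -/
lemma weighted_chebyshev_pointwise (hΦ : MonotoneOn Φ (Ioo 0 1))
    (hfin : ∀ t ∈ Ioo (0 : ℝ) 1, Φ t ≠ ⊤) (hα : α₁ < α₂) {s t : ℝ} (hs : s ∈ Ioo (0 : ℝ) 1)
    (ht : t ∈ Ioo (0 : ℝ) 1) :
    ENNReal.ofReal (2 * t * (1 - t ^ 2) ^ α₂) * Φ t +
        ENNReal.ofReal ((1 - s ^ 2) ^ (α₂ - α₁)) * Φ s *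
          ENNReal.ofReal (2 * t * (1 - t ^ 2) ^ α₁) ≤
      ENNReal.ofReal ((1 - s ^ 2) ^ (α₂ - α₁)) *
        (ENNReal.ofReal (2 * t * (1 - t ^ 2) ^ α₁) * Φ t) +
        Φ s * ENNReal.ofReal (2 * t * (1 - t ^ 2) ^ α₂) := by
  have hpos : ∀ u ∈ Ioo (0 : ℝ) 1, 0 ≤ (1 - u ^ 2) ^ (α₂ - α₁) := fun u hu ↦
    Real.rpow_nonneg (by nlinarith [hu.1, hu.2]) _
  have hw := (weight_pos α₁ ht).le
  rw [weight_eq_mul (α₁ := α₁) ht, ← ENNReal.ofReal_toReal (hfin t ht),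
    ← ENNReal.ofReal_toReal (hfin s hs),
    ofReal_weight_mul_add ENNReal.toReal_nonneg ENNReal.toReal_nonneg (hpos s hs) (hpos t ht) hw,
    ofReal_weight_mul_add' ENNReal.toReal_nonneg ENNReal.toReal_nonneg (hpos s hs) (hpos t ht) hw]
  refine ENNReal.ofReal_le_ofReal (mul_le_mul_of_nonneg_left ?_ hw)
  rcases lt_trichotomy s t with h | rfl | h
  · have h1 := ENNReal.toReal_mono (hfin t ht) (hΦ hs ht h.le)
    have h2 := rpow_lt_rpow_of_lt (sub_pos.mpr hα) hs.1 h ht.2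
    nlinarith
  · exact le_rfl
  · have h1 := ENNReal.toReal_mono (hfin s hs) (hΦ ht hs h.le)
    have h2 := rpow_lt_rpow_of_lt (sub_pos.mpr hα) ht.1 h hs.2
    nlinarith

lemma weighted_chebyshev_pointwise_strict (hΦ : StrictMonoOn Φ (Ioo 0 1))
    (hfin : ∀ t ∈ Ioo (0 : ℝ) 1, Φ t ≠ ⊤) (hα : α₁ < α₂) {s t : ℝ} (hs : s ∈ Ioo (0 : ℝ) 1)
    (ht : t ∈ Ioo (0 : ℝ) 1) (hst : t ≠ s) :
    ENNReal.ofReal (2 * t * (1 - t ^ 2) ^ α₂) * Φ t +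
        ENNReal.ofReal ((1 - s ^ 2) ^ (α₂ - α₁)) * Φ s *
          ENNReal.ofReal (2 * t * (1 - t ^ 2) ^ α₁) <
      ENNReal.ofReal ((1 - s ^ 2) ^ (α₂ - α₁)) *
        (ENNReal.ofReal (2 * t * (1 - t ^ 2) ^ α₁) * Φ t) +
        Φ s * ENNReal.ofReal (2 * t * (1 - t ^ 2) ^ α₂) := by
  have hpos : ∀ u ∈ Ioo (0 : ℝ) 1, 0 ≤ (1 - u ^ 2) ^ (α₂ - α₁) := fun u hu ↦
    Real.rpow_nonneg (by nlinarith [hu.1, hu.2]) _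
  have hw := weight_pos α₁ ht
  rw [weight_eq_mul (α₁ := α₁) ht, ← ENNReal.ofReal_toReal (hfin t ht),
    ← ENNReal.ofReal_toReal (hfin s hs),
    ofReal_weight_mul_add ENNReal.toReal_nonneg ENNReal.toReal_nonneg (hpos s hs) (hpos t ht)
      hw.le,
    ofReal_weight_mul_add' ENNReal.toReal_nonneg ENNReal.toReal_nonneg (hpos s hs) (hpos t ht)
      hw.le]
  have key : (1 - t ^ 2) ^ (α₂ - α₁) * (Φ t).toReal + (1 - s ^ 2) ^ (α₂ - α₁) * (Φ s).toReal <
      (1 - s ^ 2) ^ (α₂ - α₁) * (Φ t).toReal + (1 - t ^ 2) ^ (α₂ - α₁) * (Φ s).toReal := by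
    rcases hst.symm.lt_or_gt with h | h
    · have h1 := (ENNReal.toReal_lt_toReal (hfin s hs) (hfin t ht)).mpr (hΦ hs ht h)
      have h2 := rpow_lt_rpow_of_lt (sub_pos.mpr hα) hs.1 h ht.2
      nlinarith
    · have h1 := (ENNReal.toReal_lt_toReal (hfin t ht) (hfin s hs)).mpr (hΦ ht hs h)
      have h2 := rpow_lt_rpow_of_lt (sub_pos.mpr hα) ht.1 h hs.2
      nlinarith
  refine (ENNReal.ofReal_lt_ofReal_iff_of_nonneg ?_).mpr (mul_lt_mul_of_pos_left key hw)
  have := hpos s hs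
  have := hpos t ht
  positivity

lemma setLIntegral_weight_one (α : ℝ) :
    ∫⁻ t in Ioo (0 : ℝ) 1, ENNReal.ofReal (2 * t * (1 - t ^ 2) ^ α) =
      weightMeasure α (Ioo 0 1) :=
  (weightMeasure_apply_Ioo α le_rfl le_rfl).symm

lemma weightMeasure_Ioo_zero_one_ratio (h₁ : -1 < α₁) (h₂ : -1 < α₂) :
    weightMeasure α₂ (Ioo 0 1) =
      ENNReal.ofReal ((α₁ + 1) / (α₂ + 1)) * weightMeasure α₁ (Ioo 0 1) := by
  have h1 : 0 < α₁ + 1 := by linarith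
  have h2 : 0 < α₂ + 1 := by linarith
  rw [weightMeasure_Ioo_zero_one h₁, weightMeasure_Ioo_zero_one h₂,
    ← ENNReal.ofReal_mul (by positivity)]
  congr 1
  field_simp

/-- Chebyshev's inequality comparing two weights whose ratio is decreasing. -/
lemma weightedMean_one_anti (h₁ : -1 < α₁) (hα : α₁ < α₂) (hΦ : MonotoneOn Φ (Ioo 0 1))
    (hfin : ∀ t ∈ Ioo (0 : ℝ) 1, Φ t ≠ ⊤) :
    weightedMean α₂ Φ 1 ≤ weightedMean α₁ Φ 1 ∧
      (StrictMonoOn Φ (Ioo 0 1) → weightedMean α₂ Φ 1 < ⊤ →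
        weightedMean α₂ Φ 1 < weightedMean α₁ Φ 1) := by
  have h1 : 0 < α₁ + 1 := by linarith
  have h2 : 0 < α₂ + 1 := by linarith
  have hk0 : 0 < (α₁ + 1) / (α₂ + 1) := by positivity
  -- The point `s` is where the ratio of the weights equals the ratio of their total masses. With
  -- this choice the terms containing `Φ s` integrate to the same finite constant on both sides and
  -- cancel.
  obtain ⟨s, hs, hsk⟩ := exists_rpow_eq hk0 ((div_lt_one h2).mpr (by linarith)) (sub_pos.mpr hα)
  have hW := weightMeasure_Ioo_zero_one_ratio h₁ (h₁.trans hα)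
  have hW1 : weightMeasure α₁ (Ioo 0 1) ≠ ⊤ := by simp [weightMeasure_Ioo_zero_one h₁]
  set K := ENNReal.ofReal ((α₁ + 1) / (α₂ + 1)) with hK
  have hK0 : K ≠ 0 := (ENNReal.ofReal_pos.mpr hk0).ne'
  have hKt : K ≠ ⊤ := ENNReal.ofReal_ne_top
  have hL : ∫⁻ t in Ioo (0 : ℝ) 1, (ENNReal.ofReal (2 * t * (1 - t ^ 2) ^ α₂) * Φ t +
      K * Φ s * ENNReal.ofReal (2 * t * (1 - t ^ 2) ^ α₁)) =
      ∫⁻ t in Ioo 0 1, Φ t ∂(weightMeasure α₂) + K * Φ s * weightMeasure α₁ (Ioo 0 1) := by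
    rw [lintegral_add_right _ (by fun_prop), lintegral_const_mul _ (by fun_prop),
      setLIntegral_weight_one, setLIntegral_weightMeasure]
  have hR : ∫⁻ t in Ioo (0 : ℝ) 1, (K * (ENNReal.ofReal (2 * t * (1 - t ^ 2) ^ α₁) * Φ t) +
      Φ s * ENNReal.ofReal (2 * t * (1 - t ^ 2) ^ α₂)) =
      K * ∫⁻ t in Ioo 0 1, Φ t ∂(weightMeasure α₁) + K * Φ s * weightMeasure α₁ (Ioo 0 1) := by
    rw [lintegral_add_right _ (by fun_prop), lintegral_const_mul' _ _ hKt,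
      lintegral_const_mul _ (by fun_prop), setLIntegral_weight_one, setLIntegral_weightMeasure, hW]
    ring
  have hC : K * Φ s * weightMeasure α₁ (Ioo 0 1) ≠ ⊤ :=
    ENNReal.mul_ne_top (ENNReal.mul_ne_top hKt (hfin s hs)) hW1
  -- Both means now have the same denominator, so only numerators remain to be compared.
  have hmean : weightedMean α₁ Φ 1 =
      (K * ∫⁻ t in Ioo 0 1, Φ t ∂(weightMeasure α₁)) / weightMeasure α₂ (Ioo 0 1) := by
    rw [weightedMean, hW, ENNReal.mul_div_mul_left _ _ hK0 hKt]
  have hW20 : weightMeasure α₂ (Ioo 0 1) ≠ 0 := weightMeasure_Ioo_zero_ne_zero one_pos le_rfl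
  have hW2t : weightMeasure α₂ (Ioo 0 1) ≠ ⊤ := by
    simp [weightMeasure_Ioo_zero_one (h₁.trans hα)]
  rw [hmean, weightedMean]
  constructor
  · gcongr
    refine (ENNReal.add_le_add_iff_right hC).mp ?_
    rw [← hL, ← hR]
    refine setLIntegral_mono' measurableSet_Ioo fun t ht ↦ ?_
    have := weighted_chebyshev_pointwise hΦ hfin hα hs ht
    rwa [hsk] at this
  · intro hstrict hlt
    have hI2 : ∫⁻ t in Ioo 0 1, Φ t ∂(weightMeasure α₂) ≠ ⊤ := by
      intro htop
      rw [htop, ENNReal.top_div_of_ne_top hW2t] at hlt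
      exact hlt.ne rfl
    refine ENNReal.div_lt_div_right hW20 hW2t ?_
    refine (ENNReal.add_lt_add_iff_right hC).mp ?_
    rw [← hL, ← hR]
    have hmeas : AEMeasurable Φ (volume.restrict (Ioo 0 1)) :=
      aemeasurable_restrict_of_monotoneOn measurableSet_Ioo hΦ
    refine lintegral_strict_mono ?_ ?_ ?_ ?_
    · simp
    · fun_prop
    · rw [hL]
      exact ENNReal.add_ne_top.mpr ⟨hI2, hC⟩
    · filter_upwards [ae_restrict_mem measurableSet_Ioo,
        ae_restrict_of_ae (Measure.ae_ne volume s)] with t ht hts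
      have := weighted_chebyshev_pointwise_strict hstrict hfin hα hs ht hts
      rwa [hsk] at this

end Comparison

/-! ### Hausdorff measure of an injective `C¹` curve. -/

section ArcLength

variable {γ γ' : ℝ → ℂ} {a b s t : ℝ}

lemma hausdorffMeasure_image_Ico_le (hγ : ∀ u, HasDerivAt γ (γ' u) u) {C : ℝ} (hC0 : 0 ≤ C)
    (hC : ∀ u ∈ Icc s t, ‖γ' u‖ ≤ C) :
    Measure.hausdorffMeasure 1 (γ '' Ico s t) ≤ ENNReal.ofReal (C * (t - s)) := by
  have hlip : LipschitzOnWith (.mk C hC0) γ (Icc s t) :=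
    (convex_Icc s t).lipschitzOnWith_of_nnnorm_hasDerivWithin_le
      (fun u _ ↦ (hγ u).hasDerivWithinAt) fun u hu ↦ hC u hu
  refine ((hlip.mono Ico_subset_Icc_self).hausdorffMeasure_image_le zero_le_one).trans ?_
  rw [hausdorffMeasure_real, Real.volume_Ico, ENNReal.rpow_one, ENNReal.ofReal_mul hC0]
  gcongr
  rw [ENNReal.ofReal, Real.toNNReal_of_nonneg hC0]

/-- The 1-Lipschitz map `z ↦ dist z (γ s)` sends the arc onto a set containing `[0, ‖γ t - γ s‖]`,
by the intermediate value theorem. Dropping the endpoint `γ t` costs no measure. -/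
lemma ofReal_dist_le_hausdorffMeasure_image (hγ : ContinuousOn γ (Icc s t)) (hst : s ≤ t) :
    ENNReal.ofReal ‖γ t - γ s‖ ≤ Measure.hausdorffMeasure 1 (γ '' Ico s t) := by
  have hlip : LipschitzWith 1 fun z : ℂ ↦ dist z (γ s) := LipschitzWith.dist_left _
  have hsub : Icc 0 ‖γ t - γ s‖ ⊆ (fun z : ℂ ↦ dist z (γ s)) '' (γ '' Icc s t) := by
    rw [image_image]
    have := intermediate_value_Icc hst (hlip.continuous.comp_continuousOn hγ)
    simpa [dist_eq_norm] using this
  have hnull : Measure.hausdorffMeasure 1 {γ t} = 0 :=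
    (Measure.nullSingletonClass_hausdorff ℂ one_pos).measure_singleton _
  calc ENNReal.ofReal ‖γ t - γ s‖ = Measure.hausdorffMeasure 1 (Icc 0 ‖γ t - γ s‖) := by
        rw [hausdorffMeasure_real, Real.volume_Icc, sub_zero]
    _ ≤ Measure.hausdorffMeasure 1 ((fun z : ℂ ↦ dist z (γ s)) '' (γ '' Icc s t)) :=
        measure_mono hsub
    _ ≤ Measure.hausdorffMeasure 1 (γ '' Icc s t) := by
        simpa using hlip.hausdorffMeasure_image_le zero_le_one (γ '' Icc s t)
    _ ≤ Measure.hausdorffMeasure 1 (γ '' Ico s t ∪ {γ t}) := by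
        rw [← Ico_union_right hst, image_union, image_singleton]
    _ ≤ _ := (measure_union_le _ _).trans_eq (by rw [hnull, add_zero])

/-- The length of an injective `C¹` curve is the integral of its speed. -/
lemma hausdorffMeasure_image_Ico_eq_integral (hγ : ∀ u, HasDerivAt γ (γ' u) u)
    (hγ' : Continuous γ') (hab : a ≤ b) (hinj : InjOn γ (Ico a b)) :
    Measure.hausdorffMeasure 1 (γ '' Ico a b) = ENNReal.ofReal (∫ u in a..b, ‖γ' u‖) := by
  have hcont : Continuous γ := continuous_iff_continuousAt.mpr fun u ↦ (hγ u).continuousAt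
  set ℓ : ℝ → ℝ → ℝ≥0∞ := fun s t ↦ Measure.hausdorffMeasure 1 (γ '' Ico s t) with hℓ
  have hfin : ∀ s t, ℓ s t ≠ ⊤ := by
    intro s t
    obtain ⟨C, hC⟩ := isCompact_Icc.exists_bound_of_continuousOn (hγ'.continuousOn (s := Icc s t))
    exact ((hausdorffMeasure_image_Ico_le hγ (le_max_right C 0)
      fun u hu ↦ (hC u hu).trans (le_max_left _ _)).trans_lt ENNReal.ofReal_lt_top).ne
  -- Injectivity makes length additive over adjacent half-open arcs, so increments of `F` below are
  -- lengths of arcs.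
  have hadd : ∀ s t, a ≤ s → s ≤ t → t ≤ b → ℓ a t = ℓ a s + ℓ s t := by
    intro s t has hst htb
    have h1 : Ico s t ⊆ Ico a b := Ico_subset_Ico has htb
    have h2 : Ico a s ⊆ Ico a b := Ico_subset_Ico_right (hst.trans htb)
    simp only [hℓ]
    rw [← Ico_union_Ico_eq_Ico has hst, image_union, measure_union]
    · rw [disjoint_iff_inter_eq_empty, ← hinj.image_inter h2 h1, image_eq_empty,
        ← disjoint_iff_inter_eq_empty]
      exact disjoint_left.mpr fun u hu hu' ↦ not_le.mpr hu.2 hu'.1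
    · exact measurableSet_Ico.image_of_continuousOn_injOn hcont.continuousOn (hinj.mono h1)
  set F : ℝ → ℝ := fun t ↦ (ℓ a t).toReal with hF
  have hdiff : ∀ s t, a ≤ s → s ≤ t → t ≤ b → F t - F s = (ℓ s t).toReal := by
    intro s t has hst htb
    simp only [hF]
    rw [hadd s t has hst htb, ENNReal.toReal_add (hfin _ _) (hfin _ _), add_sub_cancel_left]
  have hupper : ∀ s t C, a ≤ s → s ≤ t → t ≤ b → 0 ≤ C → (∀ u ∈ Icc s t, ‖γ' u‖ ≤ C) →
      F t - F s ≤ C * (t - s) := by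
    intro s t C has hst htb hC0 hC
    rw [hdiff s t has hst htb]
    exact ENNReal.toReal_le_of_le_ofReal (mul_nonneg hC0 (sub_nonneg.mpr hst))
      (hausdorffMeasure_image_Ico_le hγ hC0 hC)
  have hlower : ∀ s t, a ≤ s → s ≤ t → t ≤ b → ‖γ t - γ s‖ ≤ F t - F s := by
    intro s t has hst htb
    rw [hdiff s t has hst htb]
    exact (ENNReal.ofReal_le_iff_le_toReal (hfin _ _)).mp
      (ofReal_dist_le_hausdorffMeasure_image hcont.continuousOn hst)
  have hFcont : ContinuousOn F (Icc a b) := by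
    obtain ⟨C, hC⟩ := isCompact_Icc.exists_bound_of_continuousOn (hγ'.continuousOn (s := Icc a b))
    have hC' : ∀ u ∈ Icc a b, ‖γ' u‖ ≤ max C 0 := fun u hu ↦ (hC u hu).trans (le_max_left _ _)
    have hle : ∀ s ∈ Icc a b, ∀ t ∈ Icc a b, s ≤ t → |F t - F s| ≤ max C 0 * |t - s| := by
      intro s hs t ht hst
      rw [abs_of_nonneg ((norm_nonneg _).trans (hlower s t hs.1 hst ht.2)),
        abs_of_nonneg (sub_nonneg.mpr hst)]
      exact hupper s t _ hs.1 hst ht.2 (le_max_right _ _)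
        fun u hu ↦ hC' u ⟨hs.1.trans hu.1, hu.2.trans ht.2⟩
    refine (LipschitzOnWith.of_dist_le_mul (K := ⟨max C 0, le_max_right _ _⟩) ?_).continuousOn
    intro t ht s hs
    rw [Real.dist_eq, Real.dist_eq]
    rcases le_total s t with h | h
    · exact hle s hs t ht h
    · rw [abs_sub_comm (F t), abs_sub_comm t]
      exact hle t ht s hs h
  -- The increment of `F` lies between the chord, which is `‖γ' x‖ (t - x)` up to `ε (t - x)`, and
  -- the Lipschitz bound `(‖γ' x‖ + ε) (t - x)`.
  have hFderiv : ∀ x ∈ Ioo a b, HasDerivWithinAt F ‖γ' x‖ (Ioi x) x := by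
    intro x hx
    rw [hasDerivWithinAt_iff_isLittleO, Asymptotics.isLittleO_iff]
    intro ε hε
    have h1 : ∀ᶠ t in 𝓝[>] x, ∀ u ∈ Icc x t, ‖γ' u‖ ≤ ‖γ' x‖ + ε := by
      have : ∀ᶠ u in 𝓝 x, ‖γ' u‖ < ‖γ' x‖ + ε :=
        hγ'.norm.continuousAt.eventually_lt continuousAt_const (by simpa using hε)
      obtain ⟨δ, hδ, hball⟩ := Metric.eventually_nhds_iff.mp this
      filter_upwards [Ioo_mem_nhdsGT (show x < x + δ by linarith)] with t ht u hu
      refine (hball ?_).le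
      rw [Real.dist_eq, abs_of_nonneg (sub_nonneg.mpr hu.1)]
      linarith [hu.2, ht.2]
    have h2 : ∀ᶠ t in 𝓝[>] x, ‖γ t - γ x - (t - x) • γ' x‖ ≤ ε * ‖t - x‖ :=
      ((hasDerivAt_iff_isLittleO.mp (hγ x)).def hε).filter_mono nhdsWithin_le_nhds
    filter_upwards [h1, h2, Ioo_mem_nhdsGT hx.2] with t h1 h2 ht
    have hxt : 0 ≤ t - x := sub_nonneg.mpr ht.1.le
    have hu := hupper x t _ hx.1.le ht.1.le ht.2.le (by positivity) h1
    have hl := hlower x t hx.1.le ht.1.le ht.2.le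
    have h3 : ‖(t - x) • γ' x‖ - ‖γ t - γ x‖ ≤ ‖γ t - γ x - (t - x) • γ' x‖ := by
      rw [norm_sub_rev (γ t - γ x)]
      exact norm_sub_norm_le _ _
    rw [norm_smul, Real.norm_of_nonneg hxt] at h3
    rw [Real.norm_of_nonneg hxt] at h2 ⊢
    rw [smul_eq_mul, Real.norm_eq_abs, abs_le]
    constructor <;> nlinarith
  have hint := intervalIntegral.integral_eq_sub_of_hasDeriv_right (by rwa [uIcc_of_le hab])
    (by rwa [min_eq_left hab, max_eq_right hab]) (hγ'.norm.intervalIntegrable (μ := volume) a b)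
  have hFa : F a = 0 := by simp [hF, hℓ]
  rw [hint, hFa, sub_zero, ENNReal.ofReal_toReal (hfin a b)]

end ArcLength

/-! ### Circles and monomials. -/

lemma image_circleMap_Ico (c : ℂ) {R : ℝ} (hR : 0 ≤ R) :
    circleMap c R '' Ico 0 (2 * Real.pi) = Metric.sphere c R := by
  have h := image_circleMap_Ioc c R
  rw [abs_of_nonneg hR] at h
  rw [← h, ← Ioo_union_left Real.two_pi_pos, ← Ioo_union_right Real.two_pi_pos, image_union,
    image_union, image_singleton, image_singleton]
  have := (periodic_circleMap c R) 0
  rw [zero_add] at this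
  rw [this]

lemma injOn_circleMap_Ico (c : ℂ) {R : ℝ} (hR : R ≠ 0) :
    InjOn (circleMap c R) (Ico 0 (2 * Real.pi)) :=
  injOn_circleMap_of_abs_sub_le' hR (by simp)

lemma hausdorffMeasure_sphere (c : ℂ) {R : ℝ} (hR : 0 < R) :
    Measure.hausdorffMeasure 1 (Metric.sphere c R) = ENNReal.ofReal (2 * Real.pi * R) := by
  rw [← image_circleMap_Ico c hR.le, hausdorffMeasure_image_Ico_eq_integral
    (fun u ↦ hasDerivAt_circleMap c R u) (by fun_prop) Real.two_pi_pos.le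
    (injOn_circleMap_Ico c hR.ne')]
  simp [abs_of_pos hR]

lemma image_add_mul_pow_ball (a₀ : ℂ) {a : ℂ} (ha : a ≠ 0) {n : ℕ} (hn : n ≠ 0) {t : ℝ}
    (ht : 0 < t) :
    (fun z : ℂ ↦ a₀ + a * z ^ n) '' Metric.ball 0 t = Metric.ball a₀ (‖a‖ * t ^ n) := by
  ext w
  simp only [mem_image, mem_ball_iff_norm, sub_zero]
  constructor
  · rintro ⟨z, hz, rfl⟩
    rw [add_sub_cancel_left, norm_mul, norm_pow]
    have : 0 < ‖a‖ := norm_pos_iff.mpr ha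
    gcongr
  · intro hw
    obtain ⟨z, hz⟩ := IsAlgClosed.exists_pow_nat_eq ((w - a₀) / a) (Nat.pos_of_ne_zero hn)
    refine ⟨z, lt_of_pow_lt_pow_left₀ n ht.le ?_, ?_⟩
    · rw [← norm_pow, hz, norm_div, div_lt_iff₀' (norm_pos_iff.mpr ha)]
      exact hw
    · rw [hz]
      field_simp
      ring

lemma bdryLength_add_mul_pow {f : ℂ → ℂ} {a₀ a : ℂ} {n : ℕ} (hn : n ≠ 0)
    (hf : ∀ z ∈ Metric.ball (0 : ℂ) 1, f z = a₀ + a * z ^ n) {t : ℝ} (ht : t ∈ Ioo (0 : ℝ) 1) :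
    bdryLength f t = ENNReal.ofReal (2 * Real.pi * (‖a‖ * t ^ n)) := by
  have himg : f '' Metric.ball 0 t = (fun z : ℂ ↦ a₀ + a * z ^ n) '' Metric.ball 0 t :=
    image_congr fun z hz ↦ hf z (Metric.ball_subset_ball ht.2.le hz)
  rw [bdryLength, himg]
  rcases eq_or_ne a 0 with rfl | ha
  · have hne : (Metric.ball (0 : ℂ) t).Nonempty := ⟨0, Metric.mem_ball_self ht.1⟩
    simp only [zero_mul, add_zero, hne.image_const, norm_zero, mul_zero, ENNReal.ofReal_zero]
    refine measure_mono_null isClosed_singleton.frontier_subset ?_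
    exact (Measure.nullSingletonClass_hausdorff ℂ one_pos).measure_singleton _
  · have hR : 0 < ‖a‖ * t ^ n := mul_pos (norm_pos_iff.mpr ha) (pow_pos ht.1 n)
    rw [image_add_mul_pow_ball a₀ ha hn ht.1, frontier_ball _ hR.ne', hausdorffMeasure_sphere _ hR]

/-! ### Univalent maps: boundary curve, nonvanishing derivative, logarithms. -/

section Univalent

variable {f : ℂ → ℂ}

lemma UnivalentOnDisk.isOpen_image (hf : UnivalentOnDisk f) {s : Set ℂ}
    (hs : s ⊆ Metric.ball 0 1) (hso : IsOpen s) : IsOpen (f '' s) := by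
  rcases (hf.1.analyticOnNhd Metric.isOpen_ball).is_constant_or_isOpen
    (convex_ball (0 : ℂ) 1).isPreconnected with ⟨w, hw⟩ | h
  · have h0 : (0 : ℂ) ∈ Metric.ball (0 : ℂ) 1 := by simp
    have h1 : (1 / 2 : ℂ) ∈ Metric.ball (0 : ℂ) 1 := by norm_num
    have := hf.2 h0 h1 ((hw 0 h0).trans (hw _ h1).symm)
    norm_num at this
  · exact h s hs hso

/-- The image of the open disk is open, its closure is the image of the closed disk by compactness,
and injectivity lets the set difference pass through `f`. -/
lemma UnivalentOnDisk.frontier_image_ball (hf : UnivalentOnDisk f) {t : ℝ}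
    (ht : t ∈ Ioo (0 : ℝ) 1) :
    frontier (f '' Metric.ball 0 t) = f '' Metric.sphere 0 t := by
  have hcl : Metric.closedBall (0 : ℂ) t ⊆ Metric.ball 0 1 := Metric.closedBall_subset_ball ht.2
  have hb : Metric.ball (0 : ℂ) t ⊆ Metric.ball 0 1 := Metric.ball_subset_ball ht.2.le
  have hcont : ContinuousOn f (Metric.closedBall 0 t) := hf.1.continuousOn.mono hcl
  have hclosure : closure (f '' Metric.ball 0 t) = f '' Metric.closedBall 0 t := by
    refine subset_antisymm (closure_minimal (image_mono Metric.ball_subset_closedBall)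
      ((isCompact_closedBall _ _).image_of_continuousOn hcont).isClosed) ?_
    rw [← closure_ball (0 : ℂ) ht.1.ne'] at hcont ⊢
    exact hcont.image_closure
  rw [(hf.isOpen_image hb Metric.isOpen_ball).frontier_eq, hclosure,
    ← (hf.2.mono hcl).image_sdiff_subset Metric.ball_subset_closedBall,
    Metric.closedBall_sdiff_ball]

lemma circleMap_mem_ball {t : ℝ} (ht : t ∈ Ioo (0 : ℝ) 1) (θ : ℝ) :
    circleMap 0 t θ ∈ Metric.ball (0 : ℂ) 1 := by
  rw [mem_ball_zero_iff, norm_circleMap_zero, abs_of_pos ht.1]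
  exact ht.2

lemma continuous_comp_circleMap {g : ℂ → ℂ} (hg : DifferentiableOn ℂ g (Metric.ball 0 1)) {t : ℝ}
    (ht : t ∈ Ioo (0 : ℝ) 1) : Continuous fun θ ↦ g (circleMap 0 t θ) :=
  hg.continuousOn.comp_continuous (continuous_circleMap 0 t) (circleMap_mem_ball ht)

lemma UnivalentOnDisk.bdryLength_eq (hf : UnivalentOnDisk f) {t : ℝ} (ht : t ∈ Ioo (0 : ℝ) 1) :
    bdryLength f t =
      ENNReal.ofReal (t * ∫ θ in 0..2 * Real.pi, ‖deriv f (circleMap 0 t θ)‖) := by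
  have hder : ∀ θ, HasDerivAt (fun θ ↦ f (circleMap 0 t θ))
      (deriv f (circleMap 0 t θ) * (circleMap 0 t θ * Complex.I)) θ := fun θ ↦
    (hf.1.differentiableAt (Metric.isOpen_ball.mem_nhds
      (circleMap_mem_ball ht θ))).hasDerivAt.comp θ (hasDerivAt_circleMap 0 t θ)
  have hdf : DifferentiableOn ℂ (deriv f) (Metric.ball 0 1) := hf.1.deriv Metric.isOpen_ball
  have hinj : InjOn (fun θ ↦ f (circleMap 0 t θ)) (Ico 0 (2 * Real.pi)) :=
    hf.2.comp (injOn_circleMap_Ico 0 ht.1.ne') fun θ _ ↦ circleMap_mem_ball ht θ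
  have himg : f '' Metric.sphere 0 t = (fun θ ↦ f (circleMap 0 t θ)) '' Ico 0 (2 * Real.pi) := by
    rw [← image_circleMap_Ico 0 ht.1.le, image_image]
  rw [bdryLength, hf.frontier_image_ball ht, himg, hausdorffMeasure_image_Ico_eq_integral hder
    ((continuous_comp_circleMap hdf ht).mul (by fun_prop)) Real.two_pi_pos.le hinj,
    ← intervalIntegral.integral_const_mul]
  simp [abs_of_pos ht.1, mul_comm]

/-- The derivative of a univalent function has no zeros: otherwise the continuous inverse, which is
holomorphic off an isolated point, would extend holomorphically there. -/
lemma UnivalentOnDisk.deriv_ne_zero (hf : UnivalentOnDisk f) {z₀ : ℂ}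
    (hz₀ : z₀ ∈ Metric.ball (0 : ℂ) 1) : deriv f z₀ ≠ 0 := by
  have hdiff : ∀ z ∈ Metric.ball (0 : ℂ) 1, DifferentiableAt ℂ f z := fun z hz ↦
    hf.1.differentiableAt (Metric.isOpen_ball.mem_nhds hz)
  have han : AnalyticAt ℂ (deriv f) z₀ :=
    (hf.1.deriv Metric.isOpen_ball).analyticAt (Metric.isOpen_ball.mem_nhds hz₀)
  -- Otherwise `f'` would vanish on a disk about `z₀`, and `f` would be constant there, against
  -- injectivity.
  have hisol : ∀ᶠ z in 𝓝[≠] z₀, deriv f z ≠ 0 := by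
    refine han.eventually_eq_zero_or_eventually_ne_zero.resolve_left fun h ↦ ?_
    obtain ⟨ε, hε, hball⟩ := Metric.eventually_nhds_iff_ball.mp
      (h.and (Metric.isOpen_ball.mem_nhds hz₀))
    have hz₁ : z₀ + (ε / 2 : ℝ) ∈ Metric.ball z₀ ε := by
      rw [mem_ball_iff_norm, add_sub_cancel_left, Complex.norm_real,
        Real.norm_of_nonneg (by positivity)]
      linarith
    have heq : f z₀ = f (z₀ + (ε / 2 : ℝ)) :=
      Metric.isOpen_ball.is_const_of_deriv_eq_zero (convex_ball z₀ ε).isPreconnected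
        (fun z hz ↦ (hdiff z (hball z hz).2).differentiableWithinAt)
        (fun z hz ↦ (hball z hz).1) (Metric.mem_ball_self hε) hz₁
    have := hf.2 hz₀ (hball _ hz₁).2 heq
    simp [hε.ne'] at this
  obtain ⟨ε, hε, hball⟩ := Metric.eventually_nhds_iff_ball.mp
    ((eventually_nhdsWithin_iff.mp hisol).and (Metric.isOpen_ball.mem_nhds hz₀))
  set V := Metric.ball z₀ ε
  have hV : V ⊆ Metric.ball 0 1 := fun z hz ↦ (hball z hz).2
  have hinj : InjOn f V := hf.2.mono hV
  have hz₀V : z₀ ∈ V := Metric.mem_ball_self hε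
  set F := Function.invFunOn f V
  have hFf : ∀ z ∈ V, F (f z) = z := fun z hz ↦ hinj.leftInvOn_invFunOn hz
  have hopen : IsOpen (f '' V) := hf.isOpen_image hV Metric.isOpen_ball
  -- Continuity of the inverse is the openness of `f`.
  have hFcont : ∀ z ∈ V, ContinuousAt F (f z) := by
    intro z hz
    rw [ContinuousAt, hFf z hz]
    intro N hN
    obtain ⟨W, hWN, hWo, hzW⟩ := mem_nhds_iff.mp hN
    have : f '' (W ∩ V) ∈ 𝓝 (f z) :=
      (hf.isOpen_image (inter_subset_right.trans hV) (hWo.inter Metric.isOpen_ball)).mem_nhds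
        (mem_image_of_mem f ⟨hzW, hz⟩)
    refine mem_map.mpr (mem_of_superset this ?_)
    rintro _ ⟨u, hu, rfl⟩
    simpa only [mem_preimage, hFf u hu.2] using hWN hu.1
  have hfF : ∀ w ∈ f '' V, f (F w) = w := by
    rintro _ ⟨z, hz, rfl⟩
    rw [hFf z hz]
  have hFdiff : DifferentiableOn ℂ F (f '' V \ {f z₀}) := by
    rintro _ ⟨⟨z, hz, rfl⟩, hne⟩
    have hzz : z ≠ z₀ := fun h ↦ hne (by rw [h]; rfl)
    refine (HasDerivAt.of_local_left_inverse (f := f) (f' := deriv f z) (hFcont z hz) ?_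
      ((hball z hz).1 hzz) ?_).differentiableAt.differentiableWithinAt
    · rw [hFf z hz]
      exact (hdiff z (hV hz)).hasDerivAt
    · filter_upwards [hopen.mem_nhds (mem_image_of_mem f hz)] with w hw using hfF w hw
  have hnhds : f '' V ∈ 𝓝 (f z₀) := hopen.mem_nhds (mem_image_of_mem f hz₀V)
  -- Removable singularity at `f z₀`. The chain rule for `F ∘ f = id` then forces `F' (f z₀) * f' z₀
  -- = 1`.
  have hF : DifferentiableAt ℂ F (f z₀) :=
    ((Complex.differentiableOn_compl_singleton_and_continuousAt_iff hnhds).mp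
      ⟨hFdiff, hFcont z₀ hz₀V⟩).differentiableAt hnhds
  have hcomp := hF.hasDerivAt.comp z₀ (hdiff z₀ hz₀).hasDerivAt
  have hid : HasDerivAt (F ∘ f) 1 z₀ := (hasDerivAt_id z₀).congr_of_eventuallyEq <| by
    filter_upwards [Metric.isOpen_ball.mem_nhds hz₀V] with z hz using hFf z hz
  intro h0
  have := hcomp.unique hid
  simp [h0] at this

/-- `P` is the primitive of `h' / h` on the disk with `P 0 = log (h 0)`; then `h * exp (-P)` has
zero derivative and value `1` at `0`. -/
lemma exists_eq_exp_of_ne_zero {h : ℂ → ℂ} (hd : DifferentiableOn ℂ h (Metric.ball 0 1))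
    (h0 : ∀ z ∈ Metric.ball (0 : ℂ) 1, h z ≠ 0) :
    ∃ P : ℂ → ℂ, DifferentiableOn ℂ P (Metric.ball 0 1) ∧
      ∀ z ∈ Metric.ball (0 : ℂ) 1, h z = Complex.exp (P z) := by
  have hz0 : (0 : ℂ) ∈ Metric.ball (0 : ℂ) 1 := by simp
  obtain ⟨P, hP0, hP⟩ := (((hd.deriv Metric.isOpen_ball).div hd h0).isExactOn_ball).with_val_at 0
    (Complex.log (h 0))
  refine ⟨P, fun z hz ↦ (hP z hz).differentiableAt.differentiableWithinAt, fun z hz ↦ ?_⟩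
  have hderiv : ∀ z ∈ Metric.ball (0 : ℂ) 1,
      HasDerivAt (fun z ↦ h z * Complex.exp (-P z)) 0 z := by
    intro z hz
    have h1 := (hd.differentiableAt (Metric.isOpen_ball.mem_nhds hz)).hasDerivAt
    refine (h1.mul (hP z hz).neg.cexp).congr_deriv ?_
    have := h0 z hz
    simp only [Pi.div_apply]
    field_simp
    ring
  have hconst := Metric.isOpen_ball.is_const_of_deriv_eq_zero
    (convex_ball (0 : ℂ) 1).isPreconnected
    (fun z hz ↦ (hderiv z hz).differentiableAt.differentiableWithinAt)
    (fun z hz ↦ (hderiv z hz).deriv) hz hz0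
  simp only [hP0, Complex.exp_neg, Complex.exp_log (h0 0 hz0)] at hconst
  rw [mul_inv_cancel₀ (h0 0 hz0), mul_inv_eq_one₀ (Complex.exp_ne_zero _)] at hconst
  exact hconst

end Univalent

/-! ### Parseval on circles. -/

section Parseval

variable {g : ℂ → ℂ}

/-- The coefficients of `g` at `0` given by Cauchy's formula on any circle in the unit disk. -/
lemma cauchyPowerSeries_eq_of_radius (hg : DifferentiableOn ℂ g (Metric.ball 0 1)) {s t : ℝ}
    (hs : s ∈ Ioo (0 : ℝ) 1) (ht : t ∈ Ioo (0 : ℝ) 1) :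
    cauchyPowerSeries g 0 s = cauchyPowerSeries g 0 t := by
  have h : ∀ r ∈ Ioo (0 : ℝ) 1, HasFPowerSeriesAt g (cauchyPowerSeries g 0 r) 0 := by
    intro r hr
    lift r to NNReal using hr.1.le
    exact ((hg.mono (Metric.closedBall_subset_ball hr.2)).hasFPowerSeriesOnBall
      hr.1).hasFPowerSeriesAt
  exact (h s hs).eq_formalMultilinearSeries (h t ht)

lemma fourierCoeffOn_circleMap_natCast {t : ℝ} (ht : t ≠ 0) (n : ℕ) :
    fourierCoeffOn Real.two_pi_pos (fun θ ↦ g (circleMap 0 t θ)) n =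
      t ^ n * (cauchyPowerSeries g 0 t n fun _ ↦ 1) := by
  rw [fourierCoeffOn_eq_integral, cauchyPowerSeries_apply, circleIntegral, smul_eq_mul,
    ← intervalIntegral.integral_const_mul, ← intervalIntegral.integral_const_mul,
    ← intervalIntegral.integral_smul]
  refine intervalIntegral.integral_congr fun θ _ ↦ ?_
  have htc : (t : ℂ) ≠ 0 := mod_cast ht
  have hπ : (Real.pi : ℂ) ≠ 0 := mod_cast Real.pi_ne_zero
  have hI := Complex.I_ne_zero
  have he : Complex.exp (θ * Complex.I) ≠ 0 := Complex.exp_ne_zero _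
  have hfour : fourier (-(n : ℤ)) (θ : AddCircle (2 * Real.pi - 0)) =
      (Complex.exp (θ * Complex.I) ^ n)⁻¹ := by
    rw [fourier_coe_apply, ← Complex.exp_nat_mul, ← Complex.exp_neg]
    congr 1
    push_cast
    field_simp
    ring
  simp only [hfour, deriv_circleMap, circleMap_zero, sub_zero, smul_eq_mul, Complex.real_smul,
    one_div, inv_pow, mul_pow]
  push_cast
  field_simp

/-- Up to a factor, the coefficient of index `-(n + 1)` is the contour integral of the holomorphic
function `z ^ n * g z`, which vanishes by Cauchy's theorem. -/
lemma fourierCoeffOn_circleMap_negSucc (hg : DifferentiableOn ℂ g (Metric.ball 0 1)) {t : ℝ}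
    (ht : t ∈ Ioo (0 : ℝ) 1) (n : ℕ) :
    fourierCoeffOn Real.two_pi_pos (fun θ ↦ g (circleMap 0 t θ)) (Int.negSucc n) = 0 := by
  have hcauchy : (∮ z in C(0, t), z ^ n * g z) = 0 := by
    have hd : DifferentiableOn ℂ (fun z ↦ z ^ n * g z) (Metric.ball 0 1) := by fun_prop
    refine Complex.circleIntegral_eq_zero_of_differentiable_on_off_countable ht.1.le
      countable_empty
      (hd.continuousOn.mono (Metric.closedBall_subset_ball ht.2)) fun z hz ↦ ?_
    exact hd.differentiableAt (Metric.isOpen_ball.mem_nhds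
      (Metric.ball_subset_ball ht.2.le hz.1))
  have htc : (t : ℂ) ≠ 0 := mod_cast ht.1.ne'
  have hkey : fourierCoeffOn Real.two_pi_pos (fun θ ↦ g (circleMap 0 t θ)) (Int.negSucc n) =
      (2 * Real.pi * Complex.I * t ^ (n + 1))⁻¹ * ∮ z in C(0, t), z ^ n * g z := by
    rw [fourierCoeffOn_eq_integral, circleIntegral, ← intervalIntegral.integral_const_mul,
      ← intervalIntegral.integral_smul]
    refine intervalIntegral.integral_congr fun θ _ ↦ ?_
    have hπ : (Real.pi : ℂ) ≠ 0 := mod_cast Real.pi_ne_zero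
    have hI := Complex.I_ne_zero
    have hfour : fourier (-(Int.negSucc n)) (θ : AddCircle (2 * Real.pi - 0)) =
        Complex.exp (θ * Complex.I) ^ (n + 1) := by
      rw [Int.neg_negSucc, fourier_coe_apply, ← Complex.exp_nat_mul]
      congr 1
      push_cast
      field_simp
      ring
    simp only [hfour, deriv_circleMap, circleMap_zero, smul_eq_mul, Complex.real_smul]
    push_cast
    field_simp
    ring
  rw [hkey, hcauchy, mul_zero]

lemma hasSum_sq_cauchyPowerSeries (hg : DifferentiableOn ℂ g (Metric.ball 0 1)) {t : ℝ}
    (ht : t ∈ Ioo (0 : ℝ) 1) :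
    HasSum (fun n : ℕ ↦ (t ^ n) ^ 2 * ‖cauchyPowerSeries g 0 t n fun _ ↦ 1‖ ^ 2)
      ((2 * Real.pi)⁻¹ * ∫ θ in 0..2 * Real.pi, ‖g (circleMap 0 t θ)‖ ^ 2) := by
  have hc := continuous_comp_circleMap hg ht
  have hmem : MemLp (fun θ ↦ g (circleMap 0 t θ)) 2
      (volume.restrict (Ioc 0 (2 * Real.pi))) := by
    obtain ⟨C, hC⟩ := isCompact_Icc.exists_bound_of_continuousOn
      (hc.continuousOn (s := Icc 0 (2 * Real.pi)))
    refine MemLp.of_bound hc.aestronglyMeasurable C ?_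
    filter_upwards [ae_restrict_mem measurableSet_Ioc] with θ hθ
      using hC θ (Ioc_subset_Icc_self hθ)
  have h := hasSum_sq_fourierCoeffOn Real.two_pi_pos hmem
  rw [sub_zero, smul_eq_mul] at h
  have hinj : Function.Injective ((↑) : ℕ → ℤ) := Nat.cast_injective
  rw [← hinj.hasSum_iff] at h
  · refine h.congr_fun fun n ↦ ?_
    simp [fourierCoeffOn_circleMap_natCast ht.1.ne', mul_pow, abs_of_pos ht.1]
  · intro n hn
    cases n with
    | ofNat n => exact absurd ⟨n, rfl⟩ hn
    | negSucc n => simp [fourierCoeffOn_circleMap_negSucc hg ht n]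

/-- Otherwise the Taylor series of `g` at `0`, which converges to `g` on the whole disk, would
reduce to its constant term. -/
lemma exists_cauchyPowerSeries_ne_zero (hg : DifferentiableOn ℂ g (Metric.ball 0 1))
    (hne : ¬ ConstOnDisk g) {t : ℝ} (ht : t ∈ Ioo (0 : ℝ) 1) :
    ∃ n ≠ 0, (cauchyPowerSeries g 0 t n fun _ ↦ 1) ≠ 0 := by
  by_contra! h
  refine hne ⟨cauchyPowerSeries g 0 t 0 fun _ ↦ 1, fun z hz ↦ ?_⟩
  obtain ⟨r, hzr, hr1⟩ := exists_between (mem_ball_zero_iff.mp hz)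
  have hr0 : 0 < r := (norm_nonneg z).trans_lt hzr
  lift r to NNReal using hr0.le
  have hp := (hg.mono (Metric.closedBall_subset_ball hr1)).hasFPowerSeriesOnBall hr0
  have hz' : z ∈ Metric.eball (0 : ℂ) r := by simpa [Metric.eball_coe] using hzr
  have hsum := hp.hasSum hz'
  rw [cauchyPowerSeries_eq_of_radius hg ⟨hr0, hr1⟩ ht, zero_add] at hsum
  have hterm : ∀ n ≠ 0, (cauchyPowerSeries g 0 t n fun _ ↦ z) = 0 := by
    intro n hn
    rw [FormalMultilinearSeries.apply_eq_pow_smul_coeff]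
    have : (cauchyPowerSeries g 0 t).coeff n = 0 := h n hn
    rw [this, smul_zero]
  have := hsum.unique (hasSum_single 0 hterm)
  rw [this]
  congr 1
  ext i
  exact i.elim0

/-- The quadratic means of a nonconstant holomorphic function over circles strictly increase. -/
lemma strictMonoOn_mean_sq (hg : DifferentiableOn ℂ g (Metric.ball 0 1)) (hne : ¬ ConstOnDisk g) :
    StrictMonoOn (fun t : ℝ ↦ (2 * Real.pi)⁻¹ *
      ∫ θ in 0..2 * Real.pi, ‖g (circleMap 0 t θ)‖ ^ 2) (Ioo 0 1) := by
  intro s hs t ht hst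
  have hs' := hasSum_sq_cauchyPowerSeries hg hs
  rw [cauchyPowerSeries_eq_of_radius hg hs ht] at hs'
  obtain ⟨n, hn, hcn⟩ := exists_cauchyPowerSeries_ne_zero hg hne ht
  have hs0 := hs.1.le
  refine hasSum_lt (i := n) (fun m ↦ ?_) ?_ hs' (hasSum_sq_cauchyPowerSeries hg ht)
  · exact mul_le_mul_of_nonneg_right
      (pow_le_pow_left₀ (pow_nonneg hs0 m) (pow_le_pow_left₀ hs0 hst.le m) 2) (sq_nonneg _)
  · exact mul_lt_mul_of_pos_right
      (pow_lt_pow_left₀ (pow_lt_pow_left₀ hst hs0 hn) (pow_nonneg hs0 n) two_ne_zero)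
      (pow_pos (norm_pos_iff.mpr hcn) 2)

end Parseval

/-- Since `f'` is zero-free, `f' = exp P = g²` with `g = exp (P / 2)`, so the mean of `|f'|` is the
quadratic mean of `g`. If `g` were a constant `c`, then `f` would be linear with slope `c²`. -/
lemma UnivalentOnDisk.strictMonoOn_mean_norm_deriv {f : ℂ → ℂ} (hf : UnivalentOnDisk f)
    (hlin : ¬ LinearOnDisk f) :
    StrictMonoOn (fun t : ℝ ↦ (2 * Real.pi)⁻¹ *
      ∫ θ in 0..2 * Real.pi, ‖deriv f (circleMap 0 t θ)‖) (Ioo 0 1) := by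
  obtain ⟨P, hP, hfP⟩ := exists_eq_exp_of_ne_zero (hf.1.deriv Metric.isOpen_ball)
    fun z hz ↦ hf.deriv_ne_zero hz
  have hg : DifferentiableOn ℂ (fun z ↦ Complex.exp (P z / 2)) (Metric.ball 0 1) := by fun_prop
  have hsq : ∀ z ∈ Metric.ball (0 : ℂ) 1, deriv f z = Complex.exp (P z / 2) ^ 2 := by
    intro z hz
    rw [hfP z hz, ← Complex.exp_nat_mul]
    congr 1
    push_cast
    ring
  have hne : ¬ ConstOnDisk fun z ↦ Complex.exp (P z / 2) := by
    rintro ⟨c, hc⟩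
    refine hlin ⟨f 0, c ^ 2, fun z hz ↦ ?_⟩
    have hder : ∀ z ∈ Metric.ball (0 : ℂ) 1, HasDerivAt (fun z ↦ f z - c ^ 2 * z) 0 z := by
      intro z hz
      refine (((hf.1.differentiableAt (Metric.isOpen_ball.mem_nhds hz)).hasDerivAt).sub
        ((hasDerivAt_id z).const_mul (c ^ 2))).congr_deriv ?_
      have hcz : Complex.exp (P z / 2) = c := hc z hz
      rw [hsq z hz, hcz]
      ring
    have := Metric.isOpen_ball.is_const_of_deriv_eq_zero
      (convex_ball (0 : ℂ) 1).isPreconnected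
      (fun z hz ↦ (hder z hz).differentiableAt.differentiableWithinAt)
      (fun z hz ↦ (hder z hz).deriv) hz (Metric.mem_ball_self one_pos)
    simp only [mul_zero, sub_zero] at this
    rw [← this]
    ring
  refine (strictMonoOn_mean_sq hg hne).congr fun t ht ↦ ?_
  refine congrArg (fun x ↦ (2 * Real.pi)⁻¹ * x)
    (intervalIntegral.integral_congr fun θ _ ↦ ?_)
  simp only [hsq _ (circleMap_mem_ball ht θ), norm_pow]

/-! ### Constant or strictly increasing mixed length. -/

section Dichotomy

variable {f : ℂ → ℂ} {β : ℝ}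

lemma ConstOnDisk.linearOnDisk (h : ConstOnDisk f) : LinearOnDisk f := by
  obtain ⟨c, hc⟩ := h
  exact ⟨c, 0, fun z hz ↦ by rw [hc z hz]; ring⟩

lemma constOnDisk_iff_of_linear {a₀ a : ℂ} (hf : ∀ z ∈ Metric.ball (0 : ℂ) 1, f z = a₀ + a * z) :
    ConstOnDisk f ↔ a = 0 := by
  constructor
  · rintro ⟨c, hc⟩
    have h0 : (0 : ℂ) ∈ Metric.ball (0 : ℂ) 1 := by simp
    have h1 : (1 / 2 : ℂ) ∈ Metric.ball (0 : ℂ) 1 := by norm_num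
    have h2 := (hf 0 h0).symm.trans ((hc 0 h0).trans ((hc _ h1).symm.trans (hf _ h1)))
    simpa using h2
  · rintro rfl
    exact ⟨a₀, fun z hz ↦ by rw [hf z hz]; ring⟩

/-- The normalized boundary length `L(f, t) / (2πt)` is strictly increasing unless `f` is linear,
in which case it is constant. -/
lemma exists_normalized_bdryLength (hf : UnivalentOnDisk f ∨ MonomialOnDisk f) :
    ∃ M : ℝ → ℝ, (∀ t ∈ Ioo (0 : ℝ) 1, 0 ≤ M t) ∧
      (∀ t ∈ Ioo (0 : ℝ) 1, bdryLength f t = ENNReal.ofReal (2 * Real.pi * t * M t)) ∧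
      ((StrictMonoOn M (Ioo 0 1) ∧ ¬ LinearOnDisk f) ∨
        ∃ c, (∀ t ∈ Ioo (0 : ℝ) 1, M t = c) ∧ LinearOnDisk f ∧ (c = 0 ↔ ConstOnDisk f)) := by
  by_cases hlin : LinearOnDisk f
  · obtain ⟨a₀, a, ha⟩ := hlin
    refine ⟨fun _ ↦ ‖a‖, fun _ _ ↦ norm_nonneg a, fun t ht ↦ ?_,
      Or.inr ⟨‖a‖, fun _ _ ↦ rfl, ⟨a₀, a, ha⟩, ?_⟩⟩
    · rw [bdryLength_add_mul_pow one_ne_zero (by simpa using ha) ht]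
      ring_nf
    · rw [norm_eq_zero, constOnDisk_iff_of_linear ha]
  rcases hf with hf | ⟨a₀, a, n, hn, ha⟩
  · refine ⟨fun t : ℝ ↦ (2 * Real.pi)⁻¹ *
      ∫ θ in 0..2 * Real.pi, ‖deriv f (circleMap 0 t θ)‖, fun t _ ↦ ?_, fun t ht ↦ ?_,
      Or.inl ⟨hf.strictMonoOn_mean_norm_deriv hlin, hlin⟩⟩
    · have := intervalIntegral.integral_nonneg (μ := volume) Real.two_pi_pos.le
        fun θ _ ↦ norm_nonneg (deriv f (circleMap 0 t θ))
      positivity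
    · rw [hf.bdryLength_eq ht]
      congr 1
      have := Real.pi_ne_zero
      field_simp
  · have ha0 : a ≠ 0 := by
      rintro rfl
      exact hlin ⟨a₀, 0, fun z hz ↦ by rw [ha z hz]; ring⟩
    -- The image is a disk of radius `‖a‖ t ^ n`, so `M t = ‖a‖ t ^ (n - 1)`; nonlinearity excludes
    -- `n = 1`.
    obtain ⟨m, rfl⟩ : ∃ m, n = m + 1 := ⟨n - 1, by omega⟩
    have hm : m ≠ 0 := by
      rintro rfl
      exact hlin ⟨a₀, a, fun z hz ↦ by rw [ha z hz]; ring⟩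
    refine ⟨fun t ↦ ‖a‖ * t ^ m, fun t ht ↦ ?_, fun t ht ↦ ?_, Or.inl ⟨fun s hs t _ hst ↦ ?_, hlin⟩⟩
    · have := ht.1
      positivity
    · rw [bdryLength_add_mul_pow m.succ_ne_zero ha ht, Nat.succ_eq_add_one, pow_succ]
      ring_nf
    · exact mul_lt_mul_of_pos_left (pow_lt_pow_left₀ hst hs.1.le hm) (norm_pos_iff.mpr ha0)

lemma mixedLength_eq {M : ℝ → ℝ} {t : ℝ} (ht : 0 < t)
    (h : bdryLength f t = ENNReal.ofReal (2 * Real.pi * t * M t)) :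
    mixedLength β f t = ENNReal.ofReal ((2 * Real.pi * t) ^ (1 - β) * M t) := by
  have h0 : 0 < 2 * Real.pi * t := mul_pos Real.two_pi_pos ht
  rw [mixedLength, h, ← ENNReal.ofReal_div_of_pos (Real.rpow_pos_of_pos h0 β),
    Real.rpow_sub h0, Real.rpow_one]
  ring_nf

/-- The mixed length is strictly increasing for nonexceptional maps and constant for exceptional
ones. -/
lemma mixedLength_dichotomy (hβ1 : β ≤ 1) (hf : UnivalentOnDisk f ∨ MonomialOnDisk f) :
    (∀ t ∈ Ioo (0 : ℝ) 1, mixedLength β f t ≠ ⊤) ∧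
      ((StrictMonoOn (mixedLength β f) (Ioo 0 1) ∧ ¬ Exceptional β f ∧ ¬ ConstOnDisk f) ∨
        ∃ c : ℝ≥0∞, (∀ t ∈ Ioo (0 : ℝ) 1, mixedLength β f t = c) ∧ Exceptional β f ∧
          (c = 0 ↔ ConstOnDisk f)) := by
  obtain ⟨M, hM0, hM, hcases⟩ := exists_normalized_bdryLength hf
  have hΦ : ∀ t ∈ Ioo (0 : ℝ) 1,
      mixedLength β f t = ENNReal.ofReal ((2 * Real.pi * t) ^ (1 - β) * M t) := fun t ht ↦
    mixedLength_eq ht.1 (hM t ht)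
  have hstrict : StrictMonoOn (fun t ↦ (2 * Real.pi * t) ^ (1 - β) * M t) (Ioo 0 1) →
      StrictMonoOn (mixedLength β f) (Ioo 0 1) := by
    intro h s hs t ht hst
    rw [hΦ s hs, hΦ t ht]
    refine (ENNReal.ofReal_lt_ofReal_iff_of_nonneg ?_).mpr (h hs ht hst)
    have := hM0 s hs
    have := hs.1
    positivity
  refine ⟨fun t ht ↦ by rw [hΦ t ht]; exact ENNReal.ofReal_ne_top, ?_⟩
  rcases hcases with ⟨hmono, hlin⟩ | ⟨c, hc, hlin, hc0⟩
  -- Here `M` increases strictly, and `(2πt)^(1-β)` is positive and nondecreasing because `β ≤ 1`.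
  · refine Or.inl ⟨hstrict fun s hs t ht hst ↦ ?_, ?_, fun h ↦ hlin h.linearOnDisk⟩
    · have hs0 : 0 < 2 * Real.pi * s := mul_pos Real.two_pi_pos hs.1
      exact mul_lt_mul' (Real.rpow_le_rpow hs0.le
        (mul_le_mul_of_nonneg_left hst.le Real.two_pi_pos.le) (by linarith))
        (hmono hs ht hst) (hM0 s hs)
        (Real.rpow_pos_of_pos (mul_pos Real.two_pi_pos ht.1) _)
    · rintro (⟨-, h⟩ | ⟨-, h⟩)
      · exact hlin h.linearOnDisk
      · exact hlin h
  · have hcnn : 0 ≤ c := by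
      have h2 : (1 / 2 : ℝ) ∈ Ioo (0 : ℝ) 1 := by norm_num
      exact hc _ h2 ▸ hM0 _ h2
    rcases hβ1.lt_or_eq with hβ | rfl
    · by_cases hconst : ConstOnDisk f
      · refine Or.inr ⟨0, fun t ht ↦ ?_, Or.inl ⟨hβ, hconst⟩, by simpa using hconst⟩
        rw [hΦ t ht, hc t ht, hc0.mpr hconst, mul_zero, ENNReal.ofReal_zero]
      · have hcpos : 0 < c := hcnn.lt_of_ne' fun h ↦ hconst (hc0.mp h)
        -- Here `M` is a positive constant, and strict growth comes from the power `(2πt)^(1-β)`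
        -- with `β < 1`.
        refine Or.inl ⟨hstrict fun s hs t ht hst ↦ ?_, ?_, hconst⟩
        · simp only [hc s hs, hc t ht]
          exact mul_lt_mul_of_pos_right (Real.rpow_lt_rpow
            (mul_pos Real.two_pi_pos hs.1).le
            (mul_lt_mul_of_pos_left hst Real.two_pi_pos) (by linarith)) hcpos
        · rintro (⟨-, h⟩ | ⟨h, -⟩)
          · exact hconst h
          · exact hβ.ne h
    · refine Or.inr ⟨ENNReal.ofReal c, fun t ht ↦ ?_, Or.inr ⟨rfl, hlin⟩, ?_⟩
      · rw [hΦ t ht, hc t ht, sub_self, Real.rpow_zero, one_mul]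
      · rw [← hc0, ENNReal.ofReal_eq_zero]
        exact ⟨fun h ↦ h.antisymm hcnn, fun h ↦ h.le⟩

end Dichotomy

/-! ### Assembly of the theorem. -/

lemma lengthMean_eq_weightedMean (α β : ℝ) (f : ℂ → ℂ) :
    lengthMean α β f = weightedMean α (mixedLength β f) := rfl

theorem corollary2 (β : ℝ) (hβ0 : 0 ≤ β) (hβ1 : β ≤ 1) (f : ℂ → ℂ)
    (hf : UnivalentOnDisk f ∨ MonomialOnDisk f) :
    -- the means are finite
    (∀ α : ℝ, ∀ r ∈ Ioo (0 : ℝ) 1, lengthMean α β f r < ⊤) ∧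
    -- (i)
    (∀ α : ℝ, α ≤ -1 →
      (∫⁻ t in Ioo 0 1, mixedLength β f t ∂(weightMeasure α) =
        ⨆ r ∈ Ioo (0 : ℝ) 1, ∫⁻ t in Ioo 0 r, mixedLength β f t ∂(weightMeasure α)) ∧
      (∫⁻ t in Ioo 0 1, mixedLength β f t ∂(weightMeasure α) < ⊤ ↔ ConstOnDisk f) ∧
      Tendsto (mixedLength β f) (𝓝[<] 1) (𝓝 (⨆ r ∈ Ioo (0 : ℝ) 1, lengthMean α β f r))) ∧
    -- (ii)
    (∀ α : ℝ, -1 < α →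
      (∀ r ∈ Ioo (0 : ℝ) 1, lengthMean α β f r ≤ lengthMeanOne α β f) ∧
      ((∀ r ∈ Ioo (0 : ℝ) 1, lengthMean α β f r = lengthMeanOne α β f) ↔ Exceptional β f)) ∧
    -- (iii)
    (AntitoneOn (fun α => lengthMeanOne α β f) (Ioi (-1)) ∧
      ((∀ α₁ α₂ : ℝ, -1 < α₁ → α₁ < α₂ → lengthMeanOne α₂ β f < ⊤ →
          lengthMeanOne α₂ β f < lengthMeanOne α₁ β f) ↔ ¬ Exceptional β f)) := by
  obtain ⟨hfin, hcases⟩ := mixedLength_dichotomy hβ1 hf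
  have hmono : MonotoneOn (mixedLength β f) (Ioo 0 1) := by
    rcases hcases with ⟨h, -⟩ | ⟨c, hc, -⟩
    · exact h.monotoneOn
    · intro s hs t ht _
      rw [hc s hs, hc t ht]
  have hle : ∀ α, ∀ r ∈ Ioo (0 : ℝ) 1, lengthMean α β f r ≤ lengthMeanOne α β f :=
    fun α r hr ↦ le_iSup₂_of_le r hr le_rfl
  have hconst : ∀ c : ℝ≥0∞, (∀ t ∈ Ioo (0 : ℝ) 1, mixedLength β f t = c) → ∀ α,
      lengthMeanOne α β f = c := by
    intro c hc α
    have h2 : (1 / 2 : ℝ) ∈ Ioo (0 : ℝ) 1 := by norm_num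
    exact le_antisymm (iSup₂_le fun r hr ↦ (weightedMean_const hc hr).le)
      (le_iSup₂_of_le _ h2 (weightedMean_const hc h2).ge)
  have hone : ∀ α, -1 < α → lengthMeanOne α β f = weightedMean α (mixedLength β f) 1 :=
    fun α hα ↦ iSup_weightedMean_eq_weightedMean_one hα hmono
  refine ⟨fun α r hr ↦ (weightedMean_le hmono hr).trans_lt (hfin r hr).lt_top,
    fun α hα ↦ ⟨setLIntegral_Ioo_eq_iSup _ _, ?_, ?_⟩, fun α hα ↦ ⟨hle α, ?_⟩, ?_, ?_⟩
  · rcases hcases with ⟨hstrict, -, hnc⟩ | ⟨c, hc, -, hc0⟩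
    · refine iff_of_false (fun h ↦ h.ne ?_) hnc
      -- Two sample points: `Φ (1/2) > Φ (1/3) ≥ 0` makes `Φ` nonzero at `1/2`.
      have h1 : (1 / 3 : ℝ) ∈ Ioo (0 : ℝ) 1 := by norm_num
      have h2 : (1 / 2 : ℝ) ∈ Ioo (0 : ℝ) 1 := by norm_num
      exact setLIntegral_eq_top_of_ne_zero hα hmono h2
        (hstrict h1 h2 (by norm_num)).ne_bot
    · rw [← hc0]
      constructor
      · intro h
        by_contra hne
        have h2 : (1 / 2 : ℝ) ∈ Ioo (0 : ℝ) 1 := by norm_num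
        exact h.ne (setLIntegral_eq_top_of_ne_zero hα hmono h2 (by rwa [hc _ h2]))
      · rintro rfl
        rw [setLIntegral_congr_fun measurableSet_Ioo hc]
        simp
  · rw [lengthMean_eq_weightedMean, iSup_weightedMean_eq_iSup hα hmono hfin]
    exact tendsto_iSup_of_monotoneOn hmono
  · rcases hcases with ⟨hstrict, hne, -⟩ | ⟨c, hc, hex, -⟩
    · refine iff_of_false (fun h ↦ ?_) hne
      have h1 : (1 / 3 : ℝ) ∈ Ioo (0 : ℝ) 1 := by norm_num
      have h2 : (1 / 2 : ℝ) ∈ Ioo (0 : ℝ) 1 := by norm_num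
      exact (weightedMean_strictMono (α := α) hstrict hfin h1 (by norm_num) h2.2).ne
        ((h _ h1).trans (h _ h2).symm)
    · refine iff_of_true (fun r hr ↦ ?_) hex
      rw [hconst c hc α]
      exact weightedMean_const hc hr
  · intro α₁ h₁ α₂ h₂ hα
    rcases hα.lt_or_eq with hα | rfl
    · simp only [hone α₁ h₁, hone α₂ h₂]
      exact (weightedMean_one_anti h₁ hα hmono hfin).1
    · exact le_rfl
  · rcases hcases with ⟨hstrict, hne, -⟩ | ⟨c, hc, hex, -⟩
    · refine iff_of_true (fun α₁ α₂ h₁ hα hlt ↦ ?_) hne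
      rw [hone α₂ (h₁.trans hα)] at hlt ⊢
      rw [hone α₁ h₁]
      exact (weightedMean_one_anti h₁ hα hmono hfin).2 hstrict hlt
    · refine iff_of_false (fun h ↦ ?_) (not_not.mpr hex)
      have hct : c ≠ ⊤ := by
        have h2 : (1 / 2 : ℝ) ∈ Ioo (0 : ℝ) 1 := by norm_num
        exact hc _ h2 ▸ hfin _ h2
      -- Every mean equals the finite constant `c`, so any two exponents, here `0 < 1`, would give
      -- `c < c`.
      have := h 0 1 (by norm_num) one_pos (by rw [hconst c hc]; exact hct.lt_top)
      rw [hconst c hc, hconst c hc] at this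
      exact lt_irrefl _ this
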